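/- Let $P\in\mathbb Z[\mathrm n]$ be a non-constant polynomial with integer coefficients, let $0<p\le\infty$, and let $\mathbb I\subseteq\mathbb Z_+=\{1,2,3,\dots\}$ be an infinite set. Then for every $C>0$ there exist a probability space $(X,\mu)$, an invertible bimeasurable measure-preserving map $T\colon X\to X$, and a function $f\in L^\infty(X)$ (complex-valued) with $\|f\|_{L^\infty(X)}\le 1$ such that $$\big\| (A_N^{P}f)_{N\in\mathbb I}\big\|_{L^p(X;V^2)}>C .$$ Here $A_N^{P}f(x)=\frac1N\sum_{n=1}^N f(T^{P(n)}x)$, and $\|(F_N)_{N\in\mathbb I}\|_{L^p(X;V^2)}$ denotes the $L^p(X)$ (quasi-)norm, with value in $[0,\infty]$, of the $2$-variation seminorm $$x\mapsto\sup_{J\in\mathbb Z_+}\ \sup_{\substack{t_0\le t_1\le\dots\le t_J\\ t_j\in\mathbb I}}\Big(\sum_{j=0}^{J-1}|F_{t_{j+1}}(x)-F_{t_j}(x)|^2\Big)^{1/2}.$$ -/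

import Mathlib

open MeasureTheory
open scoped ENNReal NNReal

noncomputable section

/-- The `r`-variation seminorm of a family `a` indexed by a totally ordered set `ι`, with values in
`[0, ∞]`: the supremum over all `J` and all finite sequences `t 0 ≤ t 1 ≤ ⋯ ≤ t J` in `ι` of
`(∑_{j < J} ‖a (t (j + 1)) - a (t j)‖ ^ r) ^ (1 / r)`. It is `0` if `ι` is empty. -/
def rVariation {ι B : Type*} [LinearOrder ι] [NormedAddCommGroup B] (r : ℝ) (a : ι → B) : ℝ≥0∞ :=
  ⨆ (J : ℕ) (t : Fin (J + 1) →o ι),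
    (∑ j : Fin J, ‖a (t j.succ) - a (t j.castSucc)‖ₑ ^ r) ^ (1 / r)

/-- The `L^p(X; V^r)` norm of a family `F` of functions on `X`: the `L^p` norm of the function
sending `x` to the `r`-variation seminorm of `N ↦ F N x`. -/
def eLpVariation {X ι B : Type*} [MeasurableSpace X] [LinearOrder ι] [NormedAddCommGroup B]
    (F : ι → X → B) (p : ℝ≥0∞) (r : ℝ) (μ : Measure X) : ℝ≥0∞ :=
  eLpNorm (fun x => rVariation r (fun N => F N x)) p μ

/-- The polynomial ergodic average `A_N f (x) = (1 / N) ∑_{n = 1}^{N} f (T ^ {P(n)} x)`, where `T` is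
invertible, so that negative values of `P(n)` are allowed. -/
def polyAverage {X : Type*} (T : Equiv.Perm X) (P : Polynomial ℤ) (f : X → ℂ) (N : ℕ+) (x : X) : ℂ :=
  (1 / ((N : ℕ) : ℂ)) * ∑ n ∈ Finset.Icc 1 (N : ℕ), f ((T ^ (P.eval (n : ℤ))) x)

end

/-!
Let `ε_0, …, ε_{J-1}` be independent random signs. Place them on a cycle that is much longer than
all the times involved, each `ε_j` constant on blocks of length `M_j` and independent from block to
block, and let `T` be the rotation. Take `θ = 1 / √J` and `f = exp (√-1 θ ∑ ε_j)`. If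
`N_0 ≪ M_0 ≪ N_1 ≪ M_1 ≪ ⋯` with `N_i ∈ I`, then along `P` up to time `N_i` the signs `ε_j` with
`j ≥ i` do not move, and those with `j < i` are averaged out. So `A_{N_i} f` is close to the
reversed martingale `G_i = (cos θ)^i * exp (√-1 θ ∑_{j ≥ i} ε_j)`, whose increments over short
windows are comparable to `θ` times those of the random walk with steps `ε_j`.

The squared 2-variation of that random walk is at least `C * J` with high probability, for every
`C`: at each of many scales in base `B` the `B` consecutive block sums may have equal signs, and
then one long increment beats the increments of its pieces by a factor of order `B`; the scales are
made independent by flipping the signs of blocks. Hence the 2-variation of `A_N f` is at least of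
order `√C` on a set of probability `1 / 2`, which bounds its `L^p` norm below for every `p > 0`.
-/

namespace ErgodicVariation

open Finset
open scoped BigOperators

/-! ### Uniform expectations -/

section Expectation

variable {Ω : Type*} [Fintype Ω]

lemma expect_ite_one_zero (p : Ω → Prop) [DecidablePred p] :
    𝔼 x, (if p x then (1 : ℝ) else 0) = ({x | p x} : Finset Ω).dens := by
  rw [Fintype.expect_eq_sum_div_card, sum_boole, nnratCast_dens]

lemma mul_dens_le_expect {f : Ω → ℝ} (hf : ∀ x, 0 ≤ f x) (c : ℝ) :
    c * ({x | c ≤ f x} : Finset Ω).dens ≤ 𝔼 x, f x := by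
  rw [← expect_ite_one_zero, mul_expect]
  refine expect_le_expect fun x _ => ?_
  split_ifs with h
  · simpa using h
  · simpa using hf x

lemma expect_le_mul_dens {f : Ω → ℝ} {p : Ω → Prop} [DecidablePred p] {c : ℝ}
    (hp : ∀ x, p x → f x ≤ c) (hn : ∀ x, ¬p x → f x ≤ 0) :
    𝔼 x, f x ≤ c * ({x | p x} : Finset Ω).dens := by
  rw [← expect_ite_one_zero, mul_expect]
  refine expect_le_expect fun x _ => ?_
  split_ifs with h
  · simpa using hp x h
  · simpa using hn x h

lemma expect_eq_zero_of_comp_eq_neg {f : Ω → ℝ} (e : Ω ≃ Ω) (h : ∀ x, f (e x) = -f x) :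
    𝔼 x, f x = 0 := by
  have : 𝔼 x, f x = -𝔼 x, f x := by
    rw [← expect_neg_distrib]
    exact (Fintype.expect_equiv e _ _ fun x => (h x).symm).symm
  linarith

lemma norm_expect_sq_le {ι : Type*} (s : Finset ι) (f : ι → ℂ) :
    ‖𝔼 i ∈ s, f i‖ ^ 2 ≤ 𝔼 i ∈ s, ‖f i‖ ^ 2 := by
  rcases s.eq_empty_or_nonempty with rfl | hs
  · simp
  calc ‖𝔼 i ∈ s, f i‖ ^ 2 ≤ (𝔼 i ∈ s, ‖f i‖ * 1) ^ 2 := by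
        simp only [mul_one]
        gcongr
        exact RCLike.norm_expect_le (K := ℂ)
    _ ≤ (𝔼 i ∈ s, ‖f i‖ ^ 2) * 𝔼 _i ∈ s, (1 : ℝ) ^ 2 := expect_mul_sq_le_sq_mul_sq _ _ _
    _ = 𝔼 i ∈ s, ‖f i‖ ^ 2 := by simp [expect_const hs]

lemma half_le_expect_abs [Nonempty Ω] {f : Ω → ℝ} {r : ℝ} (hr : 0 ≤ r)
    (h2 : 𝔼 x, f x ^ 2 = r ^ 2) (h4 : 𝔼 x, f x ^ 4 ≤ 3 * r ^ 4) : r / 2 ≤ 𝔼 x, |f x| := by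
  rcases hr.eq_or_lt with rfl | hr
  · simpa using expect_nonneg fun x _ => abs_nonneg (f x)
  -- the two sides differ by `|y| (|y| - 2r)² (|y| + 4r)`
  have hpoint (y : ℝ) : 12 * r ^ 2 * y ^ 2 - y ^ 4 ≤ 16 * r ^ 3 * |y| := by
    have : 0 ≤ |y| * ((|y| - 2 * r) ^ 2 * (|y| + 4 * r)) := by positivity
    have h2 : |y| ^ 2 = y ^ 2 := sq_abs y
    have h4 : |y| ^ 4 = y ^ 4 := by rw [← abs_pow, abs_of_nonneg (by positivity)]
    linear_combination this - 12 * r ^ 2 * h2 + h4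
  have hmean := expect_le_expect (s := univ) fun x _ => hpoint (f x)
  rw [expect_sub_distrib, ← mul_expect, ← mul_expect, h2] at hmean
  refine le_of_mul_le_mul_left ?_ (show 0 < 16 * r ^ 3 by positivity)
  linear_combination hmean + h4 + pow_pos hr 4

/-- Both sides count the pairs `(g, x)`: for fixed `x`, the element `g * π x` runs over `G`. -/
lemma expect_comp_of_equivariant {G : Type*} [Group G] [Fintype G] [Nonempty Ω]
    (e : G → Equiv.Perm Ω) (π : Ω → G) (h : ∀ g x, π (e g x) = g * π x) (φ : G → ℝ) :
    𝔼 x, φ (π x) = 𝔼 g, φ g :=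
  calc 𝔼 x, φ (π x) = 𝔼 g : G, 𝔼 x, φ (π (e g x)) := by
        have hinv (g : G) : 𝔼 x, φ (π (e g x)) = 𝔼 x, φ (π x) :=
          Fintype.expect_equiv (e g) _ _ fun _ => rfl
        simp only [hinv, Fintype.expect_const]
    _ = 𝔼 x, 𝔼 g, φ (g * π x) := by rw [expect_comm]; simp only [h]
    _ = 𝔼 g, φ g := by
        have hinv (x : Ω) : 𝔼 g, φ (g * π x) = 𝔼 g, φ g :=
          Fintype.expect_equiv (Equiv.mulRight (π x)) _ _ fun _ => rfl
        simp only [hinv, Fintype.expect_const]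

lemma expect_expect_mul_left {G ι : Type*} [Group G] [Fintype G] [Fintype ι] [Nonempty ι]
    (τ : ι → G) (f : G → ℝ) : 𝔼 x, 𝔼 i, f (τ i * x) = 𝔼 x, f x := by
  have hinv (i : ι) : 𝔼 x, f (τ i * x) = 𝔼 x, f x :=
    Fintype.expect_equiv (Equiv.mulLeft (τ i)) _ _ fun _ => rfl
  rw [expect_comm]
  simp only [hinv, Fintype.expect_const]

end Expectation

/-! ### Functions of disjoint sets of coordinates -/

section Product

variable {κ : Type*} [Fintype κ] [DecidableEq κ] {α : κ → Type*} [∀ i, Fintype (α i)]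

lemma expect_mul_of_dependsOn {s t : Set κ} (hst : Disjoint s t) {f g : (Π i, α i) → ℝ}
    (hf : DependsOn f s) (hg : DependsOn g t) :
    𝔼 x, f x * g x = (𝔼 x, f x) * 𝔼 x, g x := by
  classical
  -- exchanging the coordinates in `s` of two points is an involution
  let swap : (Π i, α i) × (Π i, α i) → (Π i, α i) × (Π i, α i) :=
    fun p => (s.piecewise p.1 p.2, s.piecewise p.2 p.1)
  have hswap : Function.Involutive swap := fun p => by
    ext i <;> by_cases hi : i ∈ s <;> simp [swap, hi]
  have hfg : 𝔼 p : (Π i, α i) × (Π i, α i), f p.1 * g p.2 =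
      𝔼 p : (Π i, α i) × (Π i, α i), f p.1 * g p.1 := by
    refine Fintype.expect_equiv hswap.toPerm _ _ fun p => ?_
    congr 1
    · exact hf fun i hi => by simp [swap, hi]
    · exact hg fun i hi => by simp [swap, hst.notMem_of_mem_right hi]
  rw [expect_mul_expect, ← expect_product', univ_product_univ, hfg, ← univ_product_univ,
    expect_product]
  rcases isEmpty_or_nonempty (Π i, α i) with h | h
  · simp
  · simp only [Fintype.expect_const]

variable {ι : Type*} [∀ i, Nonempty (α i)]

lemma expect_sq_sum_sub_expect_le {I : Finset ι} {s : ι → Set κ}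
    (hs : (I : Set ι).PairwiseDisjoint s) {W : ι → (Π i, α i) → ℝ} {b : ℝ}
    (hW : ∀ i ∈ I, DependsOn (W i) (s i)) (hWb : ∀ i ∈ I, ∀ x, W i x ∈ Set.Icc 0 b) :
    𝔼 x, (∑ i ∈ I, (W i x - 𝔼 y, W i y)) ^ 2 ≤ #I * b ^ 2 := by
  set V : ι → (Π i, α i) → ℝ := fun i x => W i x - 𝔼 y, W i y with hV
  have hV0 (i : ι) : 𝔼 x, V i x = 0 := by simp [hV, expect_sub_distrib]
  have hVdep (i) (hi : i ∈ I) : DependsOn (V i) (s i) := fun x y hxy => by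
    simp only [hV, hW i hi hxy]
  have hdiag (i) (hi : i ∈ I) : 𝔼 x, V i x * V i x ≤ b ^ 2 := by
    refine expect_le univ_nonempty fun x _ => ?_
    have hx := hWb i hi x
    have hmean : 𝔼 y, W i y ∈ Set.Icc 0 b :=
      ⟨expect_nonneg fun y _ => (hWb i hi y).1,
        expect_le univ_nonempty fun y _ => (hWb i hi y).2⟩
    rw [← sq]
    exact sq_le_sq' (by linarith [hx.1, hmean.2]) (by linarith [hx.2, hmean.1])
  have hcross (i) (hi : i ∈ I) (j) (hj : j ∈ I) (hij : i ≠ j) : 𝔼 x, V i x * V j x = 0 := by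
    rw [expect_mul_of_dependsOn (hs hi hj hij) (hVdep i hi) (hVdep j hj), hV0, zero_mul]
  simp only [sq, sum_mul_sum, expect_sum_comm]
  calc ∑ i ∈ I, ∑ j ∈ I, 𝔼 x, V i x * V j x = ∑ i ∈ I, 𝔼 x, V i x * V i x :=
        sum_congr rfl fun i hi => sum_eq_single_of_mem i hi fun j hj hji =>
          hcross i hi j hj hji.symm
    _ ≤ #I * (b * b) := by
        rw [← sq, ← nsmul_eq_mul]
        exact sum_le_card_nsmul _ _ _ hdiag

lemma dens_sum_lt_le {I : Finset ι} (hI : I.Nonempty) {s : ι → Set κ}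
    (hs : (I : Set ι).PairwiseDisjoint s) {W : ι → (Π i, α i) → ℝ} {a b c : ℝ} (hac : a < c)
    (hW : ∀ i ∈ I, DependsOn (W i) (s i)) (hWb : ∀ i ∈ I, ∀ x, W i x ∈ Set.Icc 0 b)
    (hc : ∀ i ∈ I, c ≤ 𝔼 x, W i x) :
    (({x | ∑ i ∈ I, W i x < #I * a} : Finset (Π i, α i)).dens : ℝ) ≤
      b ^ 2 / ((c - a) ^ 2 * #I) := by
  have hcard : (0 : ℝ) < #I := by exact_mod_cast hI.card_pos
  have hdev (x) (hx : ∑ i ∈ I, W i x < #I * a) :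
      (#I * (c - a)) ^ 2 ≤ (∑ i ∈ I, (W i x - 𝔼 y, W i y)) ^ 2 := by
    have hmean : #I * c ≤ ∑ i ∈ I, 𝔼 y, W i y := by
      rw [← nsmul_eq_mul]
      exact card_nsmul_le_sum _ _ _ hc
    rw [sum_sub_distrib, ← neg_sq (_ - _)]
    have := mul_pos hcard (sub_pos.2 hac)
    exact pow_le_pow_left₀ this.le (by linarith) 2
  have hmarkov := (mul_dens_le_expect (fun x => sq_nonneg (∑ i ∈ I, (W i x - 𝔼 y, W i y)))
    ((#I * (c - a)) ^ 2)).trans (expect_sq_sum_sub_expect_le hs hW hWb)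
  have hsub : (({x | ∑ i ∈ I, W i x < #I * a} : Finset (Π i, α i)).dens : ℝ) ≤
      ({x | (#I * (c - a)) ^ 2 ≤ (∑ i ∈ I, (W i x - 𝔼 y, W i y)) ^ 2} : Finset _).dens := by
    exact_mod_cast dens_le_dens (monotone_filter_right _ fun x _ => hdev x)
  have : 0 < c - a := sub_pos.2 hac
  rw [le_div_iff₀ (by positivity)]
  refine le_of_mul_le_mul_left ?_ hcard
  nlinarith [mul_le_mul_of_nonneg_left hsub (sq_nonneg (#I * (c - a)))]

end Product

/-! ### Random signs -/

section Signs

lemma sq_sign (u : ℤˣ) : ((u : ℤ) : ℝ) ^ 2 = 1 := by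
  rcases Int.units_eq_one_or u with rfl | rfl <;> simp

variable {ι : Type*} [DecidableEq ι]

lemma sum_mulSingle_mul_of_notMem {s : Finset ι} {i : ι} (hi : i ∉ s) (x : ι → ℤˣ) :
    ∑ j ∈ s, (((Pi.mulSingle i (-1) * x : ι → ℤˣ) j : ℤ) : ℝ) = ∑ j ∈ s, ((x j : ℤ) : ℝ) :=
  sum_congr rfl fun j hj => by
    rw [Pi.mul_apply, Pi.mulSingle_eq_of_ne (ne_of_mem_of_not_mem hj hi), one_mul]

variable [Fintype ι]

lemma expect_mul_sign_eq_zero {i : ι} {F : (ι → ℤˣ) → ℝ}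
    (hF : ∀ x, F (Pi.mulSingle i (-1) * x) = F x) : 𝔼 x, F x * (x i : ℤ) = 0 :=
  expect_eq_zero_of_comp_eq_neg (Equiv.mulLeft (Pi.mulSingle i (-1))) fun x => by
    simp [hF]

lemma expect_signSum_sq (s : Finset ι) :
    𝔼 x : ι → ℤˣ, (∑ i ∈ s, ((x i : ℤ) : ℝ)) ^ 2 = #s := by
  induction s using Finset.induction_on with
  | empty => simp
  | insert i s hi ih =>
    have hodd : 𝔼 x : ι → ℤˣ, (∑ j ∈ s, ((x j : ℤ) : ℝ)) * (x i : ℤ) = 0 :=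
      expect_mul_sign_eq_zero (sum_mulSingle_mul_of_notMem hi)
    have hexpand (x : ι → ℤˣ) : (∑ j ∈ insert i s, ((x j : ℤ) : ℝ)) ^ 2 =
        (∑ j ∈ s, ((x j : ℤ) : ℝ)) ^ 2 + 2 * ((∑ j ∈ s, ((x j : ℤ) : ℝ)) * (x i : ℤ)) + 1 := by
      rw [sum_insert hi]
      linear_combination sq_sign (x i)
    simp only [hexpand, expect_add_distrib, ← mul_expect, hodd, ih, Fintype.expect_const,
      card_insert_of_notMem hi]
    push_cast
    ring

lemma expect_signSum_pow_four_le (s : Finset ι) :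
    𝔼 x : ι → ℤˣ, (∑ i ∈ s, ((x i : ℤ) : ℝ)) ^ 4 ≤ 3 * (#s : ℝ) ^ 2 := by
  induction s using Finset.induction_on with
  | empty => simp
  | insert i s hi ih =>
    set S : (ι → ℤˣ) → ℝ := fun x => ∑ j ∈ s, ((x j : ℤ) : ℝ)
    have hodd : 𝔼 x : ι → ℤˣ, (4 * S x ^ 3 + 4 * S x) * (x i : ℤ) = 0 :=
      expect_mul_sign_eq_zero fun x => by simp only [S, sum_mulSingle_mul_of_notMem hi]
    have hexpand (x : ι → ℤˣ) : (∑ j ∈ insert i s, ((x j : ℤ) : ℝ)) ^ 4 =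
        S x ^ 4 + (4 * S x ^ 3 + 4 * S x) * (x i : ℤ) + 6 * S x ^ 2 + 1 := by
      rw [sum_insert hi]
      linear_combination (6 * S x ^ 2 + 4 * S x * (x i : ℤ) + (x i : ℤ) ^ 2 + 1) * sq_sign (x i)
    simp only [hexpand, expect_add_distrib, ← mul_expect, hodd, S, expect_signSum_sq,
      Fintype.expect_const, card_insert_of_notMem hi]
    push_cast
    linarith

lemma sqrt_card_div_two_le_expect_abs_signSum (s : Finset ι) :
    √(#s) / 2 ≤ 𝔼 x : ι → ℤˣ, |∑ i ∈ s, ((x i : ℤ) : ℝ)| := by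
  have hsq : √(#s : ℝ) ^ 2 = #s := Real.sq_sqrt (Nat.cast_nonneg _)
  refine half_le_expect_abs (Real.sqrt_nonneg _) (by rw [hsq, expect_signSum_sq]) ?_
  rw [show √(#s : ℝ) ^ 4 = (√(#s : ℝ) ^ 2) ^ 2 by ring, hsq]
  exact expect_signSum_pow_four_le s

/-- With probability at least `(1 / 2) ^ |ι|` the signs `σ` make all terms nonnegative. -/
lemma add_le_expect_max_sq_signSum (w : ℝ) (D : ι → ℝ) :
    w + (1 / 2) ^ Fintype.card ι * ((∑ i, |D i|) ^ 2 - w) ≤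
      𝔼 σ : ι → ℤˣ, max w ((∑ i, ((σ i : ℤ) : ℝ) * D i) ^ 2) := by
  let σ₀ : ι → ℤˣ := fun i => if 0 ≤ D i then 1 else -1
  have habs (i : ι) : ((σ₀ i : ℤ) : ℝ) * D i = |D i| := by
    by_cases hD : 0 ≤ D i
    · simp [σ₀, hD, abs_of_nonneg]
    · simp [σ₀, hD, abs_of_neg (not_le.1 hD)]
  have hgain (σ : ι → ℤˣ) : (if σ = σ₀ then (∑ i, |D i|) ^ 2 - w else 0) ≤
      max w ((∑ i, ((σ i : ℤ) : ℝ) * D i) ^ 2) - w := by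
    split_ifs with hσ
    · simp [hσ, habs]
    · simp
  have hmean := expect_le_expect (s := univ) fun σ _ => hgain σ
  rw [expect_sub_distrib, Fintype.expect_const, Fintype.expect_ite_eq', NNRat.smul_def] at hmean
  have hcard : (((Fintype.card (ι → ℤˣ) : ℚ≥0)⁻¹ : ℚ≥0) : ℝ) = (1 / 2) ^ Fintype.card ι := by simp
  linear_combination hmean - hcard * ((∑ i, |D i|) ^ 2 - w)

end Signs

/-! ### The sign walk and its quadratic variation -/

/-- The sequence of steps of the simple random walk driven by the signs `x`, continued by `1` beyond
the `J` random signs, so that sums of steps can be taken over intervals of `ℕ`. -/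
noncomputable def signPath {J : ℕ} (x : Fin J → ℤˣ) (j : ℕ) : ℝ :=
  ((Function.extend Fin.val x 1 j : ℤˣ) : ℤ)

section SignPath

variable {J : ℕ}

lemma signPath_val (x : Fin J → ℤˣ) (j : Fin J) : signPath x j = (x j : ℤ) := by
  rw [signPath, Fin.val_injective.extend_apply]

lemma signPath_mul (x y : Fin J → ℤˣ) (j : ℕ) :
    signPath (x * y) j = signPath x j * signPath y j := by
  have := congrFun (Function.extend_mul Fin.val x y 1 1) j
  simp only [mul_one, Pi.mul_apply] at this
  simp [signPath, this]

lemma abs_signPath (x : Fin J → ℤˣ) (j : ℕ) : |signPath x j| = 1 := by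
  rw [← sq_eq_sq₀ (abs_nonneg _) zero_le_one, sq_abs, signPath, sq_sign, one_pow]

lemma dependsOn_signPath {s : Set (Fin J)} {j : ℕ} (hs : ∀ i : Fin J, (i : ℕ) = j → i ∈ s) :
    DependsOn (fun x : Fin J → ℤˣ => signPath x j) s := fun x y hxy => by
  by_cases hj : j < J
  · have hxyj := hxy ⟨j, hj⟩ (hs _ rfl)
    have hval (z : Fin J → ℤˣ) : signPath z j = (z ⟨j, hj⟩ : ℤ) := signPath_val z ⟨j, hj⟩
    simp only [hval, hxyj]
  · have hval (z : Fin J → ℤˣ) : signPath z j = 1 := by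
      rw [signPath, Function.extend_apply' _ _ _ fun ⟨i, hi⟩ => hj (hi ▸ i.2)]
      simp
    simp only [hval]

lemma sqrt_div_two_le_expect_abs_sum_signPath {a l : ℕ} (h : a + l ≤ J) :
    √l / 2 ≤ 𝔼 x : Fin J → ℤˣ, |∑ j ∈ Ico a (a + l), signPath x j| := by
  let s : Finset (Fin J) := (Ico a (a + l)).attachFin fun j hj => (mem_Ico.1 hj).2.trans_le h
  have hsum (x : Fin J → ℤˣ) :
      ∑ j ∈ Ico a (a + l), signPath x j = ∑ i ∈ s, ((x i : ℤ) : ℝ) := by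
    rw [← map_valEmbedding_attachFin fun j hj => (mem_Ico.1 hj).2.trans_le h]
    simp only [sum_map, Fin.valEmbedding_apply, signPath_val, s]
  have hcard : #s = l := by rw [card_attachFin, Nat.card_Ico, Nat.add_sub_cancel_left]
  simpa only [hsum, hcard] using sqrt_card_div_two_le_expect_abs_signSum s

end SignPath

/-- A lower bound for the square of the `2`-variation of the path with steps `e` over the window
`[a, a + B ^ k]`: it is computed along `B`-adic subdivisions, where at each scale one either
subdivides or takes a single long increment. -/
def blockVar (B : ℕ) (e : ℕ → ℝ) : ℕ → ℕ → ℝ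
  | 0, a => e a ^ 2
  | k + 1, a => max (∑ i : Fin B, blockVar B e k (a + i * B ^ k))
      ((∑ j ∈ Ico a (a + B ^ (k + 1)), e j) ^ 2)

section BlockVar

variable {B : ℕ}

lemma add_mul_add_le (a l : ℕ) (i : Fin B) : a + i * l + l ≤ a + B * l := by
  rw [add_assoc, ← Nat.succ_mul]
  gcongr
  exact i.2

lemma sub_div_eq_of_mem_Ico {a l i j : ℕ} (hj : j ∈ Ico (a + i * l) (a + i * l + l)) :
    (j - a) / l = i := by
  rw [mem_Ico] at hj
  exact (Nat.div_eq_iff (by omega)).2 ⟨by omega, by omega⟩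

lemma sum_Ico_eq_sum_windows {M : Type*} [AddCommMonoid M] (e : ℕ → M) (a l n : ℕ) :
    ∑ j ∈ Ico a (a + n * l), e j = ∑ i : Fin n, ∑ j ∈ Ico (a + i * l) (a + i * l + l), e j := by
  induction n with
  | zero => simp
  | succ n ih =>
    rw [Fin.sum_univ_castSucc, ← Fin.val_last n]
    simp only [Fin.val_castSucc, ← ih, Fin.val_last]
    rw [sum_Ico_consecutive _ (by omega) (by omega), add_mul, one_mul, add_assoc]

lemma blockVar_nonneg (e : ℕ → ℝ) (k a : ℕ) : 0 ≤ blockVar B e k a := by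
  cases k with
  | zero => exact sq_nonneg _
  | succ k => exact le_max_of_le_right (sq_nonneg _)

lemma blockVar_le {e : ℕ → ℝ} (he : ∀ j, |e j| = 1) (k a : ℕ) :
    blockVar B e k a ≤ ((B : ℝ) ^ k) ^ 2 := by
  induction k generalizing a with
  | zero => simp [blockVar, ← sq_abs (e a), he]
  | succ k ih =>
    refine max_le ?_ ?_
    · calc ∑ i : Fin B, blockVar B e k (a + i * B ^ k) ≤ ∑ _i : Fin B, ((B : ℝ) ^ k) ^ 2 :=
            sum_le_sum fun i _ => ih _
        _ = B * ((B : ℝ) ^ k) ^ 2 := by simp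
        _ ≤ (B : ℝ) ^ 2 * ((B : ℝ) ^ k) ^ 2 := by
            gcongr
            exact_mod_cast Nat.le_self_pow two_ne_zero B
        _ = ((B : ℝ) ^ (k + 1)) ^ 2 := by ring
    · rw [← sq_abs]
      gcongr
      simpa [he] using abs_sum_le_sum_abs e (Ico a (a + B ^ (k + 1)))

lemma blockVar_eq_of_eq_mul {e e' : ℕ → ℝ} {s : ℝ} (hs : s ^ 2 = 1) {k a : ℕ}
    (h : ∀ j ∈ Ico a (a + B ^ k), e' j = s * e j) : blockVar B e' k a = blockVar B e k a := by
  induction k generalizing a with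
  | zero => simp [blockVar, h a (by simp), mul_pow, hs]
  | succ k ih =>
    simp only [blockVar]
    congr 1
    · refine sum_congr rfl fun i _ => ih fun j hj => h j ?_
      have := add_mul_add_le a (B ^ k) i
      rw [mem_Ico] at hj ⊢
      rw [pow_succ']
      omega
    · rw [sum_congr rfl h, ← mul_sum, mul_pow, hs, one_mul]

lemma dependsOn_blockVar_signPath {J : ℕ} (B k a : ℕ) :
    DependsOn (fun x : Fin J → ℤˣ => blockVar B (signPath x) k a)
      {j | (j : ℕ) ∈ Ico a (a + B ^ k)} := fun x y hxy =>
  blockVar_eq_of_eq_mul (one_pow 2) fun j hj => by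
    rw [one_mul]
    exact dependsOn_signPath (fun i hi => by simpa only [Set.mem_ofPred_eq, hi] using hj) hxy

end BlockVar

/-- The change of signs which multiplies all signs in the window `[a + i * l, a + (i + 1) * l)`
by `σ i`. -/
noncomputable def blockFlip {J B : ℕ} (a l : ℕ) (σ : Fin B → ℤˣ) : Fin J → ℤˣ :=
  fun j => Function.extend Fin.val σ 1 ((j - a) / l)

section BlockFlip

variable {J B : ℕ}

lemma signPath_blockFlip_mul {a l : ℕ} (σ : Fin B → ℤˣ) (x : Fin J → ℤˣ) (i : Fin B) {j : ℕ}
    (hj : j ∈ Ico (a + i * l) (a + i * l + l)) (hJ : j < J) :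
    signPath (blockFlip a l σ * x) j = (σ i : ℤ) * signPath x j := by
  rw [signPath_mul, signPath_val (blockFlip a l σ) ⟨j, hJ⟩, blockFlip,
    sub_div_eq_of_mem_Ico hj, Fin.val_injective.extend_apply]

lemma blockVar_succ_blockFlip_mul {k a : ℕ} (h : a + B ^ (k + 1) ≤ J) (σ : Fin B → ℤˣ)
    (x : Fin J → ℤˣ) :
    blockVar B (signPath (blockFlip a (B ^ k) σ * x)) (k + 1) a =
      max (∑ i : Fin B, blockVar B (signPath x) k (a + i * B ^ k))
        ((∑ i : Fin B, ((σ i : ℤ) : ℝ) *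
          ∑ j ∈ Ico (a + i * B ^ k) (a + i * B ^ k + B ^ k), signPath x j) ^ 2) := by
  rw [pow_succ'] at h
  have hflip (i : Fin B) : ∀ j ∈ Ico (a + i * B ^ k) (a + i * B ^ k + B ^ k),
      signPath (blockFlip a (B ^ k) σ * x) j = (σ i : ℤ) * signPath x j := fun j hj =>
    signPath_blockFlip_mul σ x i hj ((mem_Ico.1 hj).2.trans_le ((add_mul_add_le a _ i).trans h))
  rw [blockVar, pow_succ' B k, sum_Ico_eq_sum_windows]
  simp only [mul_sum, sum_congr rfl (hflip _), blockVar_eq_of_eq_mul (sq_sign _) (hflip _)]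

lemma le_expect_sq_sum_abs_windows {a l : ℕ} (h : a + B * l ≤ J) :
    (B : ℝ) ^ 2 * l / 4 ≤ 𝔼 x : Fin J → ℤˣ,
      (∑ i : Fin B, |∑ j ∈ Ico (a + i * l) (a + i * l + l), signPath x j|) ^ 2 := by
  set Y : (Fin J → ℤˣ) → ℝ :=
    fun x => ∑ i : Fin B, |∑ j ∈ Ico (a + i * l) (a + i * l + l), signPath x j| with hY
  have hmean : B * (√l / 2) ≤ 𝔼 x, Y x := by
    rw [hY, expect_sum_comm]
    simpa using card_nsmul_le_sum univ _ _ fun i _ =>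
      sqrt_div_two_le_expect_abs_sum_signPath ((add_mul_add_le a l i).trans h)
  calc (B : ℝ) ^ 2 * l / 4 = (B * (√l / 2)) ^ 2 := by
        rw [mul_pow, div_pow, Real.sq_sqrt (Nat.cast_nonneg _)]
        ring
    _ ≤ (𝔼 x, Y x * 1) ^ 2 := by
        simp only [mul_one]
        gcongr
    _ ≤ (𝔼 x, Y x ^ 2) * 𝔼 _x : Fin J → ℤˣ, (1 : ℝ) ^ 2 := expect_mul_sq_le_sq_mul_sq _ _ _
    _ = 𝔼 x, Y x ^ 2 := by simp

/-- Flipping the signs of the `B` blocks of a window does not change their block variations, but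
aligns the `B` block sums with probability `(1 / 2) ^ B`. -/
lemma le_expect_blockVar_succ {k a : ℕ} (h : a + B ^ (k + 1) ≤ J) :
    (1 - (1 / 2) ^ B) * ∑ i : Fin B, 𝔼 x : Fin J → ℤˣ, blockVar B (signPath x) k (a + i * B ^ k) +
      (1 / 2) ^ B * (B / 4 * B ^ (k + 1)) ≤
      𝔼 x : Fin J → ℤˣ, blockVar B (signPath x) (k + 1) a := by
  set W : (Fin J → ℤˣ) → ℝ := fun x => ∑ i : Fin B, blockVar B (signPath x) k (a + i * B ^ k)
    with hW
  set D : Fin B → (Fin J → ℤˣ) → ℝ :=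
    fun i x => ∑ j ∈ Ico (a + i * B ^ k) (a + i * B ^ k + B ^ k), signPath x j
  calc _ = 𝔼 x, W x + (1 / 2) ^ B * ((B : ℝ) ^ 2 * (B ^ k : ℕ) / 4 - 𝔼 x, W x) := by
        rw [hW, expect_sum_comm]
        push_cast
        ring
    _ ≤ 𝔼 x, W x + (1 / 2) ^ B * (𝔼 x, (∑ i, |D i x|) ^ 2 - 𝔼 x, W x) := by
        gcongr
        exact le_expect_sq_sum_abs_windows (pow_succ' B k ▸ h)
    _ = 𝔼 x, (W x + (1 / 2) ^ B * ((∑ i, |D i x|) ^ 2 - W x)) := by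
        rw [expect_add_distrib, ← mul_expect, expect_sub_distrib]
    _ ≤ 𝔼 x, 𝔼 σ : Fin B → ℤˣ, max (W x) ((∑ i, ((σ i : ℤ) : ℝ) * D i x) ^ 2) :=
        expect_le_expect fun x _ => by
          simpa using add_le_expect_max_sq_signSum (W x) fun i => D i x
    _ = 𝔼 x : Fin J → ℤˣ, blockVar B (signPath x) (k + 1) a := by
        simp only [W, D, ← blockVar_succ_blockFlip_mul h]
        exact expect_expect_mul_left _ fun x => blockVar B (signPath x) (k + 1) a

lemma le_expect_blockVar {k a : ℕ} (h : a + B ^ k ≤ J) :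
    B / 4 * (1 - (1 - (1 / 2) ^ B) ^ k) * B ^ k ≤
      𝔼 x : Fin J → ℤˣ, blockVar B (signPath x) k a := by
  induction k generalizing a with
  | zero => simpa using expect_nonneg fun x _ => blockVar_nonneg (signPath x) 0 a
  | succ k ih =>
    have hwindows : B * (B / 4 * (1 - (1 - (1 / 2) ^ B) ^ k) * B ^ k) ≤
        ∑ i : Fin B, 𝔼 x : Fin J → ℤˣ, blockVar B (signPath x) k (a + i * B ^ k) := by
      simpa using card_nsmul_le_sum univ _ _ fun (i : Fin B) _ =>
        ih ((add_mul_add_le a (B ^ k) i).trans (pow_succ' B k ▸ h))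
    have hδ : (0 : ℝ) ≤ 1 - (1 / 2) ^ B := sub_nonneg.2 (pow_le_one₀ (by norm_num) (by norm_num))
    refine le_trans (le_of_eq ?_) ((add_le_add_left (mul_le_mul_of_nonneg_left hwindows hδ) _).trans
      (le_expect_blockVar_succ h))
    ring

end BlockFlip

lemma pairwiseDisjoint_windows (m l : ℕ) :
    ((univ : Finset (Fin m)) : Set (Fin m)).PairwiseDisjoint
      fun i => {j : Fin (m * l) | (j : ℕ) ∈ Ico (i * l) (i * l + l)} := by
  have hdiv {i j : ℕ} (hj : j ∈ Ico (i * l) (i * l + l)) : j / l = i := by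
    simpa using sub_div_eq_of_mem_Ico (a := 0) (by simpa using hj)
  exact fun i _ i' _ hne => Set.disjoint_left.2 fun j hj hj' =>
    hne (Fin.ext ((hdiv hj).symm.trans (hdiv hj')))

lemma exists_dens_sum_blockVar_lt_le (C : ℕ) : ∃ B k : ℕ, 0 < B ∧ ∀ m, 4 * (B ^ k) ^ 2 ≤ m →
    (({x : Fin (m * B ^ k) → ℤˣ |
      ∑ i : Fin m, blockVar B (signPath x) k (i * B ^ k) < m * (C * B ^ k)} : Finset _).dens : ℝ) ≤
      1 / 4 := by
  obtain ⟨k, hk⟩ : ∃ k, (1 - (1 / 2 : ℝ) ^ (8 * (C + 1))) ^ k < 1 / 2 :=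
    exists_pow_lt_of_lt_one (by norm_num) (sub_lt_self _ (by positivity))
  refine ⟨8 * (C + 1), k, by omega, fun m hm => ?_⟩
  set B := 8 * (C + 1) with hB
  have hl : (0 : ℝ) < B ^ k := by positivity
  have hlm : 4 * ((B : ℝ) ^ k) ^ 2 ≤ m := by exact_mod_cast hm
  have hm0 : (0 : ℝ) < m := lt_of_lt_of_le (by positivity) hlm
  have : NeZero m := ⟨by exact_mod_cast hm0.ne'⟩
  have hmean (i : Fin m) : (C + 1) * (B : ℝ) ^ k ≤
      𝔼 x : Fin (m * B ^ k) → ℤˣ, blockVar B (signPath x) k (i * B ^ k) := by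
    refine le_trans ?_ (le_expect_blockVar (by simpa using add_mul_add_le 0 (B ^ k) i))
    gcongr
    rw [hB]
    push_cast
    nlinarith
  have hcheb := dens_sum_lt_le (a := C * (B : ℝ) ^ k) univ_nonempty
    (pairwiseDisjoint_windows m (B ^ k)) (by linarith)
    (fun i _ => dependsOn_blockVar_signPath B k (i * B ^ k))
    (fun i _ x => ⟨blockVar_nonneg _ _ _, blockVar_le (abs_signPath x) _ _⟩) fun i _ => hmean i
  rw [card_univ, Fintype.card_fin] at hcheb
  refine hcheb.trans ?_
  rw [show (C + 1) * (B : ℝ) ^ k - C * B ^ k = B ^ k by ring, div_le_div_iff₀ (by positivity)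
    (by norm_num)]
  linear_combination ((B : ℝ) ^ k) ^ 2 * hlm

/-! ### Variation along partitions -/

/-- `IsPartitionSum d a b v` says that `v = ∑ j, d (t j) (t (j + 1))` for some finite sequence
`a = t 0 ≤ ⋯ ≤ t n = b`. Sequences of this kind are the competitors in the supremum defining
`rVariation`. -/
inductive IsPartitionSum {ι : Type*} [Preorder ι] (d : ι → ι → ℝ) : ι → ι → ℝ → Prop
  | refl (a : ι) : IsPartitionSum d a a 0
  | snoc {a b c : ι} {v : ℝ} (h : IsPartitionSum d a b v) (hbc : b ≤ c) :
      IsPartitionSum d a c (v + d b c)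

section PartitionSum

variable {ι : Type*}

lemma IsPartitionSum.trans [Preorder ι] {d : ι → ι → ℝ} {a b c : ι} {v w : ℝ}
    (h : IsPartitionSum d a b v) (h' : IsPartitionSum d b c w) :
    IsPartitionSum d a c (v + w) := by
  induction h' with
  | refl => simpa using h
  | snoc _ hbc ih =>
    rw [← add_assoc]
    exact ih.snoc hbc

lemma IsPartitionSum.single [Preorder ι] (d : ι → ι → ℝ) {a b : ι} (h : a ≤ b) :
    IsPartitionSum d a b (d a b) := by
  simpa using (IsPartitionSum.refl (d := d) a).snoc h

lemma IsPartitionSum.exists_orderHom [Preorder ι] {d : ι → ι → ℝ} {a b : ι} {v : ℝ}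
    (h : IsPartitionSum d a b v) : ∃ (n : ℕ) (t : Fin (n + 1) →o ι),
      t (Fin.last n) = b ∧ ∑ j : Fin n, d (t j.castSucc) (t j.succ) = v := by
  induction h with
  | refl => exact ⟨0, ⟨fun _ => a, monotone_const⟩, rfl, by simp⟩
  | @snoc b c v _ hbc ih =>
    obtain ⟨n, t, htb, htv⟩ := ih
    have hmono : Monotone (Fin.snoc t c : Fin (n + 2) → ι) :=
      Fin.monotone_iff_le_succ.2 fun j => by
        induction j using Fin.lastCases with
        | last => simpa [htb] using hbc
        | cast j =>
          rw [Fin.succ_castSucc, Fin.snoc_castSucc, Fin.snoc_castSucc]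
          exact t.monotone (Fin.castSucc_le_succ j)
    refine ⟨n + 1, ⟨Fin.snoc t c, hmono⟩, by simp, ?_⟩
    rw [Fin.sum_univ_castSucc, ← htv]
    simp only [OrderHom.coe_mk, Fin.succ_castSucc, Fin.snoc_castSucc, Fin.succ_last, Fin.snoc_last,
      htb]

lemma IsPartitionSum.ofReal_rpow_le_rVariation [LinearOrder ι] {E : Type*} [NormedAddCommGroup E]
    {r : ℝ} (hr : 0 ≤ r) {F : ι → E} {a b : ι} {v : ℝ}
    (h : IsPartitionSum (fun s t => ‖F t - F s‖ ^ r) a b v) :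
    ENNReal.ofReal (v ^ (1 / r)) ≤ rVariation r F := by
  obtain ⟨n, t, -, rfl⟩ := h.exists_orderHom
  refine le_trans (le_of_eq ?_) (le_iSup₂ n t)
  rw [← ENNReal.ofReal_rpow_of_nonneg (sum_nonneg fun _ _ => by positivity) (by positivity),
    ENNReal.ofReal_sum_of_nonneg fun _ _ => by positivity]
  simp only [← ENNReal.ofReal_rpow_of_nonneg (norm_nonneg _) hr, ofReal_norm]

lemma rVariation_comp_le [LinearOrder ι] {ι' E : Type*} [LinearOrder ι'] [NormedAddCommGroup E]
    (r : ℝ) (F : ι → E) {N : ι' → ι} (hN : Monotone N) :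
    rVariation r (fun i => F (N i)) ≤ rVariation r F :=
  iSup₂_le fun n t => le_iSup₂ (f := fun (n : ℕ) (t : Fin (n + 1) →o ι) =>
    (∑ j : Fin n, ‖F (t j.succ) - F (t j.castSucc)‖ₑ ^ r) ^ (1 / r)) n
    ⟨fun j => N (t j), hN.comp t.monotone⟩

lemma exists_isPartitionSum_windows {d : ℕ → ℕ → ℝ} {a l n : ℕ} {w : Fin n → ℝ}
    (h : ∀ i : Fin n, ∃ v, IsPartitionSum d (a + i * l) (a + i * l + l) v ∧ w i ≤ v) :
    ∃ v, IsPartitionSum d a (a + n * l) v ∧ ∑ i, w i ≤ v := by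
  induction n with
  | zero => exact ⟨0, by simpa using IsPartitionSum.refl a, by simp⟩
  | succ n ih =>
    obtain ⟨v, hv, hwv⟩ := ih fun i => h i.castSucc
    obtain ⟨v', hv', hwv'⟩ := h (Fin.last n)
    refine ⟨v + v', ?_, by simpa [Fin.sum_univ_castSucc] using add_le_add hwv hwv'⟩
    rw [Nat.succ_mul, ← add_assoc]
    exact hv.trans hv'

lemma exists_isPartitionSum_blockVar {B k a : ℕ} {d : ℕ → ℕ → ℝ} {e : ℕ → ℝ} {κ : ℝ}
    (h : ∀ s t, a ≤ s → s ≤ t → t ≤ a + B ^ k → κ * (∑ j ∈ Ico s t, e j) ^ 2 ≤ d s t) :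
    ∃ v, IsPartitionSum d a (a + B ^ k) v ∧ κ * blockVar B e k a ≤ v := by
  induction k generalizing a with
  | zero =>
    refine ⟨d a (a + 1), IsPartitionSum.single d (by omega), ?_⟩
    simpa [blockVar] using h a (a + 1) le_rfl (by omega) (by simp)
  | succ k ih =>
    rw [blockVar]
    rcases le_total (∑ i : Fin B, blockVar B e k (a + i * B ^ k))
      ((∑ j ∈ Ico a (a + B ^ (k + 1)), e j) ^ 2) with hlong | hsub
    · rw [max_eq_right hlong]
      exact ⟨_, IsPartitionSum.single d (by omega), h _ _ le_rfl (by omega) le_rfl⟩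
    · rw [max_eq_left hsub, mul_sum, pow_succ']
      refine exists_isPartitionSum_windows fun i => ih fun s t hs hst ht => ?_
      have hfit := pow_succ' B k ▸ add_mul_add_le a (B ^ k) i
      exact h s t (by omega) hst (by omega)

end PartitionSum

/-! ### The exponential martingale -/

/-- A martingale for the decreasing filtration generated by the signs with index `≥ i`: averaging
`G i` over the `i`-th sign gives `G (i + 1)`. -/
structure IsReverseSignMartingale {J : ℕ} (G : ℕ → (Fin J → ℤˣ) → ℂ) : Prop where
  dependsOn (i : ℕ) : DependsOn (G i) {j | i ≤ j}
  average (i : Fin J) (x : Fin J → ℤˣ) :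
    G i x + G i (Pi.mulSingle i (-1) * x) = 2 * G (i + 1) x

/-- The conditional expectation of `exp (iθ ∑ j, ε j)` given the signs `ε j` with `j ≥ i`. -/
noncomputable def expMart {J : ℕ} (θ : ℝ) (i : ℕ) (x : Fin J → ℤˣ) : ℂ :=
  (Real.cos θ : ℂ) ^ i * Complex.exp ((θ * ∑ j ∈ Ico i J, signPath x j : ℝ) * Complex.I)

section Martingale

variable {J : ℕ}

lemma mulSingle_mul_apply_of_ne {i j : Fin J} (h : j ≠ i) (x : Fin J → ℤˣ) :
    (Pi.mulSingle i (-1) * x : Fin J → ℤˣ) j = x j := by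
  rw [Pi.mul_apply, Pi.mulSingle_eq_of_ne h, one_mul]

lemma IsReverseSignMartingale.sub_succ_mulSingle_mul {G : ℕ → (Fin J → ℤˣ) → ℂ}
    (hG : IsReverseSignMartingale G) (i : Fin J) (x : Fin J → ℤˣ) :
    G i (Pi.mulSingle i (-1) * x) - G (i + 1) (Pi.mulSingle i (-1) * x) =
      -(G i x - G (i + 1) x) := by
  have hindep : G (i + 1) (Pi.mulSingle i (-1) * x) = G (i + 1) x :=
    hG.dependsOn _ fun j hj => mulSingle_mul_apply_of_ne (fun hji => by simp [hji] at hj) x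
  linear_combination hG.average i x - hindep

lemma norm_expMart_le (θ : ℝ) (i : ℕ) (x : Fin J → ℤˣ) : ‖expMart θ i x‖ ≤ 1 := by
  rw [expMart, norm_mul, Complex.norm_exp_ofReal_mul_I, mul_one, norm_pow, Complex.norm_real]
  exact pow_le_one₀ (norm_nonneg _) (Real.abs_cos_le_one θ)

lemma isReverseSignMartingale_expMart (θ : ℝ) :
    IsReverseSignMartingale (expMart (J := J) θ) where
  dependsOn i x y hxy := by
    have hsum : ∑ j ∈ Ico i J, signPath x j = ∑ j ∈ Ico i J, signPath y j :=
      sum_congr rfl fun j hj =>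
        dependsOn_signPath
          (fun k hk => by simpa only [Set.mem_ofPred_eq, hk] using (mem_Ico.1 hj).1) hxy
    rw [expMart, expMart, hsum]
  average i x := by
    have htail : ∑ j ∈ Ico (i + 1 : ℕ) J, signPath (Pi.mulSingle i (-1) * x) j =
        ∑ j ∈ Ico (i + 1 : ℕ) J, signPath x j :=
      sum_congr rfl fun j hj => dependsOn_signPath (s := {i}ᶜ)
        (fun k hk hki => by simp_all) fun k hk => mulSingle_mul_apply_of_ne hk x
    have hsum (s : ℝ) (hs : s = 1 ∨ s = -1) : Complex.exp ((θ * s : ℝ) * Complex.I) +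
        Complex.exp ((θ * -s : ℝ) * Complex.I) = 2 * Real.cos θ := by
      rcases hs with rfl | rfl <;>
        simp only [Complex.exp_mul_I, mul_one, mul_neg, neg_neg, Complex.ofReal_neg,
          Complex.cos_neg, Complex.sin_neg, Complex.ofReal_cos] <;> ring
    have hflip : signPath (Pi.mulSingle i (-1) * x) i = -signPath x i := by
      simp [signPath_val]
    have hexp := hsum (signPath x i) (eq_or_eq_neg_of_abs_eq (abs_signPath x i))
    simp only [expMart, sum_eq_sum_Ico_succ_bot i.2, htail, hflip, mul_add, Complex.ofReal_add,
      add_mul, Complex.exp_add]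
    linear_combination (Real.cos θ : ℂ) ^ (i : ℕ) *
      Complex.exp ((θ * ∑ j ∈ Ico (i + 1 : ℕ) J, signPath x j : ℝ) * Complex.I) * hexp

lemma half_le_cos_pow {θ : ℝ} {n : ℕ} (h : θ ^ 2 * n ≤ 1) : 1 / 2 ≤ Real.cos θ ^ n := by
  rcases n.eq_zero_or_pos with rfl | hn
  · norm_num
  have hθ : θ ^ 2 ≤ 1 :=
    (le_mul_of_one_le_right (sq_nonneg θ) (by exact_mod_cast hn)).trans h
  calc (1 : ℝ) / 2 ≤ 1 + n * -(θ ^ 2 / 2) := by linarith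
    _ ≤ (1 + -(θ ^ 2 / 2)) ^ n := one_add_mul_le_pow (by linarith) n
    _ ≤ Real.cos θ ^ n :=
        pow_le_pow_left₀ (by linarith) (by linarith [Real.one_sub_sq_div_two_le_cos (x := θ)]) n

/-- After rotating away the common phase, it suffices to compare imaginary parts. -/
lemma abs_div_four_le_norm_expMart_sub {θ : ℝ} (hθ : θ ^ 2 * J ≤ 1) (x : Fin J → ℤˣ) {s t : ℕ}
    (hst : s ≤ t) (ht : t ≤ J) (hS : |θ * ∑ j ∈ Ico s t, signPath x j| ≤ 1) :
    |θ * ∑ j ∈ Ico s t, signPath x j| / 4 ≤ ‖expMart θ t x - expMart θ s x‖ := by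
  set φ := θ * ∑ j ∈ Ico s t, signPath x j with hφ
  have hrotate : expMart θ s x - expMart θ t x =
      Complex.exp ((θ * ∑ j ∈ Ico t J, signPath x j : ℝ) * Complex.I) *
        ((Real.cos θ ^ s : ℝ) * Complex.exp (φ * Complex.I) - (Real.cos θ ^ t : ℝ)) := by
    rw [expMart, expMart, ← sum_Ico_consecutive _ hst ht, mul_add, ← hφ, Complex.ofReal_add,
      add_mul, Complex.exp_add]
    push_cast
    ring
  have hcos : 1 / 2 ≤ Real.cos θ ^ s := half_le_cos_pow <|
    (mul_le_mul_of_nonneg_left (by exact_mod_cast hst.trans ht) (sq_nonneg θ)).trans hθ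
  have hsin : |φ| / 2 ≤ |Real.sin φ| := by
    refine le_trans ?_ (Real.mul_abs_le_abs_sin (by linarith [Real.pi_gt_three]))
    rw [div_eq_inv_mul]
    gcongr
    rw [inv_eq_one_div, div_le_div_iff₀ two_pos Real.pi_pos]
    linarith [Real.pi_le_four]
  rw [norm_sub_rev, hrotate, norm_mul, Complex.norm_exp_ofReal_mul_I, one_mul]
  calc |φ| / 4 = 1 / 2 * (|φ| / 2) := by ring
    _ ≤ Real.cos θ ^ s * |Real.sin φ| := by gcongr
    _ = |((Real.cos θ ^ s : ℝ) * Complex.exp (φ * Complex.I) - (Real.cos θ ^ t : ℝ) : ℂ).im| := by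
        rw [Complex.sub_im, Complex.im_ofReal_mul, Complex.exp_ofReal_mul_I_im, Complex.ofReal_im,
          sub_zero, abs_mul, abs_of_nonneg (by linarith : 0 ≤ Real.cos θ ^ s)]
    _ ≤ _ := Complex.abs_im_le_norm _

lemma one_le_abs_sum_signPath {x : Fin J → ℤˣ} {s : Finset ℕ} (h : ∑ j ∈ s, signPath x j ≠ 0) :
    1 ≤ |∑ j ∈ s, signPath x j| := by
  simp only [signPath] at h ⊢
  norm_cast at h ⊢
  exact Int.one_le_abs h

lemma sq_div_le_norm_sub_sq_of_close {θ : ℝ} (hθ : θ ^ 2 * J ≤ 1) {x : Fin J → ℤˣ} {F : ℕ → ℂ}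
    (hF : ∀ i ≤ J, ‖F i - expMart θ i x‖ ≤ |θ| / 16) {s t : ℕ} (hst : s ≤ t) (ht : t ≤ J)
    (hts : |θ| * (t - s : ℕ) ≤ 1) :
    θ ^ 2 / 64 * (∑ j ∈ Ico s t, signPath x j) ^ 2 ≤ ‖F t - F s‖ ^ 2 := by
  set S := ∑ j ∈ Ico s t, signPath x j
  rcases eq_or_ne S 0 with hS0 | hS0
  · rw [hS0]
    simp
  have hSle : |S| ≤ (t - s : ℕ) := by
    simpa [abs_signPath] using abs_sum_le_sum_abs (signPath x) (Ico s t)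
  have hθS : |θ| * 1 ≤ |θ * S| := by
    rw [abs_mul]
    gcongr
    exact one_le_abs_sum_signPath hS0
  have hmart := abs_div_four_le_norm_expMart_sub hθ x hst ht
    (by rw [abs_mul]; exact (mul_le_mul_of_nonneg_left hSle (abs_nonneg θ)).trans hts)
  have htriangle : ‖expMart θ t x - expMart θ s x‖ ≤
      ‖F t - F s‖ + (‖F t - expMart θ t x‖ + ‖F s - expMart θ s x‖) := by
    rw [show expMart θ t x - expMart θ s x =
      (F t - F s) - ((F t - expMart θ t x) - (F s - expMart θ s x)) by ring]
    exact (norm_sub_le _ _).trans (by gcongr; exact norm_sub_le _ _)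
  have hbound : |θ * S| / 8 ≤ ‖F t - F s‖ := by
    linarith [hF t ht, hF s (hst.trans ht)]
  calc θ ^ 2 / 64 * S ^ 2 = (|θ * S| / 8) ^ 2 := by rw [div_pow, sq_abs]; ring
    _ ≤ ‖F t - F s‖ ^ 2 := by gcongr

end Martingale

lemma ofReal_rpow_sum_blockVar_le_rVariation {B k m : ℕ} {θ : ℝ} (hθ : θ ^ 2 * (m * B ^ k : ℕ) ≤ 1)
    (hl : |θ| * B ^ k ≤ 1) {x : Fin (m * B ^ k) → ℤˣ} {F : ℕ → ℂ}
    (hF : ∀ i ≤ m * B ^ k, ‖F i - expMart θ i x‖ ≤ |θ| / 16) :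
    ENNReal.ofReal
        ((θ ^ 2 / 64 * ∑ i : Fin m, blockVar B (signPath x) k (i * B ^ k)) ^ (1 / 2 : ℝ)) ≤
      rVariation 2 F := by
  obtain ⟨v, hv, hle⟩ := exists_isPartitionSum_windows (a := 0) (l := B ^ k) (n := m)
    (d := fun s t => ‖F t - F s‖ ^ (2 : ℝ))
    (w := fun i => θ ^ 2 / 64 * blockVar B (signPath x) k (0 + i * B ^ k)) fun i =>
      exists_isPartitionSum_blockVar fun s t hs hst ht => by
        have hfit := add_mul_add_le 0 (B ^ k) i
        rw [Real.rpow_two]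
        refine sq_div_le_norm_sub_sq_of_close hθ hF hst (by omega) (le_trans ?_ hl)
        gcongr
        exact_mod_cast (by omega : t - s ≤ B ^ k)
  refine le_trans (ENNReal.ofReal_le_ofReal ?_) (hv.ofReal_rpow_le_rVariation zero_le_two)
  refine Real.rpow_le_rpow (mul_nonneg (by positivity)
    (sum_nonneg fun i _ => blockVar_nonneg _ _ _)) ?_ (by norm_num)
  simpa only [mul_sum, zero_add] using hle

lemma exists_martingale_large_variation (r : ℕ) : ∃ (J : ℕ) (G : ℕ → (Fin J → ℤˣ) → ℂ) (η : ℝ),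
    0 < η ∧ IsReverseSignMartingale G ∧ (∀ i x, ‖G i x‖ ≤ 1) ∧
      ∃ s : Finset (Fin J → ℤˣ), (s.dens : ℝ) ≤ 1 / 4 ∧ ∀ x ∉ s, ∀ F : ℕ → ℂ,
        (∀ i ≤ J, ‖F i - G i x‖ ≤ η) → (r : ℝ≥0∞) ≤ rVariation 2 F := by
  obtain ⟨B, k, hB, hdens⟩ := exists_dens_sum_blockVar_lt_le (64 * r ^ 2)
  set l := B ^ k with hl
  set m := 4 * l ^ 2 with hm
  have hl1 : 1 ≤ l := Nat.one_le_pow _ _ hB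
  set θ : ℝ := 1 / √(m * l : ℕ) with hθ
  have hJ : 0 < m * l := by positivity
  have hθJ : θ ^ 2 * (m * l : ℕ) = 1 := by
    rw [hθ, div_pow, one_pow, Real.sq_sqrt (Nat.cast_nonneg _)]
    field_simp
  have hθ0 : 0 < θ := by positivity
  have hθl : |θ| * (B : ℝ) ^ k ≤ 1 := by
    have hll : l ^ 2 ≤ m * l := by nlinarith
    refine (sq_le_one_iff₀ (by positivity)).1 ?_
    calc (|θ| * (B : ℝ) ^ k) ^ 2 = θ ^ 2 * (l ^ 2 : ℕ) := by
          rw [mul_pow, sq_abs, hl]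
          push_cast
          ring
      _ ≤ θ ^ 2 * (m * l : ℕ) := by gcongr
      _ = 1 := hθJ
  refine ⟨m * l, expMart θ, |θ| / 16, div_pos (abs_pos.2 hθ0.ne') (by norm_num),
    isReverseSignMartingale_expMart θ, norm_expMart_le θ, _, hdens m le_rfl, fun x hx F hF => ?_⟩
  refine le_trans ?_ (ofReal_rpow_sum_blockVar_le_rVariation hθJ.le hθl hF)
  rw [← ENNReal.ofReal_natCast]
  refine ENNReal.ofReal_le_ofReal ?_
  rw [← Real.sqrt_eq_rpow]
  refine Real.le_sqrt_of_sq_le ?_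
  simp only [mem_filter_univ, not_lt] at hx
  calc (r : ℝ) ^ 2 = θ ^ 2 * (m * l : ℕ) * r ^ 2 := by rw [hθJ, one_mul]
    _ = θ ^ 2 / 64 * (m * ((64 * r ^ 2 : ℕ) * l)) := by push_cast; ring
    _ ≤ _ := by gcongr; exact_mod_cast hx

/-! ### The phase space -/

section EquivDens

variable {X Y : Type*} [Fintype X]

lemma dens_filter_comp_equiv (e : X ≃ X) (p : X → Prop) [DecidablePred p] :
    ({x | p (e x)} : Finset X).dens = ({x | p x} : Finset X).dens := by
  rw [← dens_map_equiv e]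
  congr 1
  ext x
  simp

lemma dens_product_univ [Fintype Y] [Nonempty Y] (s : Finset X) :
    (s ×ˢ (univ : Finset Y)).dens = s.dens := by
  rw [dens, dens, card_product, Fintype.card_prod, card_univ]
  push_cast
  exact mul_div_mul_right _ _ (Nat.cast_ne_zero.2 Fintype.card_ne_zero)

variable [DecidableEq Y]

lemma dens_comp_pow_ne_le (T : Equiv.Perm X) (β : X → Y) (n : ℕ) :
    (({x | β ((T ^ n) x) ≠ β x} : Finset X).dens : ℝ) ≤
      n * ({x | β (T x) ≠ β x} : Finset X).dens := by
  classical
  induction n with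
  | zero => simp
  | succ n ih =>
    have hsub : ({x | β ((T ^ (n + 1)) x) ≠ β x} : Finset X) ⊆
        ({x | β (T ((T ^ n) x)) ≠ β ((T ^ n) x)} : Finset X) ∪
          ({x | β ((T ^ n) x) ≠ β x} : Finset X) := fun x hx => by
      simp only [mem_union, mem_filter_univ, pow_succ', Equiv.Perm.mul_apply] at hx ⊢
      by_contra! h
      exact hx (h.1.trans h.2)
    have hunion := (dens_le_dens hsub).trans (dens_union_le _ _)
    rw [dens_filter_comp_equiv (T ^ n) fun x => β (T x) ≠ β x] at hunion
    calc _ ≤ (({x | β (T x) ≠ β x} : Finset X).dens : ℝ) +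
          (({x | β ((T ^ n) x) ≠ β x} : Finset X).dens : ℝ) := by exact_mod_cast hunion
      _ ≤ _ := by rw [Nat.cast_succ, add_mul, one_mul, add_comm]; gcongr

lemma dens_comp_zpow_ne_le (T : Equiv.Perm X) (β : X → Y) (k : ℤ) :
    (({x | β ((T ^ k) x) ≠ β x} : Finset X).dens : ℝ) ≤
      k.natAbs * ({x | β (T x) ≠ β x} : Finset X).dens := by
  obtain ⟨n, rfl | rfl⟩ := k.eq_nat_or_neg
  · simpa using dens_comp_pow_ne_le T β n
  · rw [← dens_filter_comp_equiv (T ^ n)]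
    simpa [ne_comm] using dens_comp_pow_ne_le T β n

end EquivDens

/-- The index of the block of length `M` containing `m`, for the standard representatives
`0, …, L - 1` of the residues; the last block may be shorter. -/
def block {L : ℕ} [NeZero L] (M : ℕ) (m : ZMod L) : Fin L :=
  ⟨m.val / M, (Nat.div_le_self _ _).trans_lt (ZMod.val_lt m)⟩

section Block

variable {L M : ℕ} [NeZero L]

lemma dvd_val_of_block_add_one_ne {m : ZMod L} (h : block M (m + 1) ≠ block M m) :
    M ∣ (m + 1).val := by
  rcases (Nat.succ_le_of_lt (ZMod.val_lt m)).eq_or_lt with hL | hL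
  · have hval : (m + 1).val = 0 := by
      rw [ZMod.val_eq_zero, ← ZMod.natCast_zmod_val m]
      exact_mod_cast (congrArg (Nat.cast (R := ZMod L)) hL).trans (ZMod.natCast_self L)
    simp [hval]
  · have hval : (m + 1).val = m.val + 1 := by
      rw [← Nat.succ_eq_add_one, ← ZMod.val_natCast_of_lt hL]
      simp
    by_contra hdvd
    rw [hval] at hdvd
    exact h (Fin.ext (by simp only [block, hval, Nat.succ_div_of_not_dvd hdvd]))

lemma dens_block_add_one_ne_le (hM : 0 < M) (hML : M ≤ L) :
    (({m : ZMod L | block M (m + 1) ≠ block M m} : Finset (ZMod L)).dens : ℝ) ≤ 2 / M := by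
  have hcard : #{m : ZMod L | block M (m + 1) ≠ block M m} ≤ L / M + 1 := by
    refine (card_le_card_of_injOn (fun m => (m + 1).val / M) (t := range (L / M + 1)) ?_ ?_).trans
      (card_range _).le
    · intro m _
      simpa [Nat.lt_succ_iff] using Nat.div_le_div_right (ZMod.val_lt (m + 1)).le
    · intro m hm m' hm' heq
      have hdvd := dvd_val_of_block_add_one_ne (mem_filter_univ m |>.1 hm)
      have hdvd' := dvd_val_of_block_add_one_ne (mem_filter_univ m' |>.1 hm')
      exact add_right_cancel (ZMod.val_injective L ((Nat.div_left_inj hdvd hdvd').1 heq))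
  have hL : 0 < L := NeZero.pos L
  rw [nnratCast_dens, ZMod.card, div_le_div_iff₀ (by positivity) (by positivity)]
  have hmul : (L / M + 1) * M ≤ 2 * L := by
    have := Nat.div_mul_le_self L M
    linarith [add_mul (L / M) 1 M]
  exact_mod_cast (Nat.mul_le_mul_right M hcard).trans hmul

lemma block_add_ne_of_le (hM : 0 < M) (m : ZMod L) {a b : ℤ} (hab : (M : ℤ) ≤ |a - b|)
    (hL : |a - b| + M ≤ L) : block M (m + (a : ZMod L)) ≠ block M (m + (b : ZMod L)) := by
  intro h
  set v := (m + (a : ZMod L)).val with hv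
  set w := (m + (b : ZMod L)).val with hw
  have hvw : |(v : ℤ) - w| < M := by
    have hdv := Nat.div_add_mod v M
    have hdw := Nat.div_add_mod w M
    have hmv := Nat.mod_lt v hM
    have hmw := Nat.mod_lt w hM
    rw [show v / M = w / M from congrArg Fin.val h] at hdv
    rw [abs_lt]
    omega
  have hdvd : (L : ℤ) ∣ (a - b) - ((v : ℤ) - w) := by
    rw [← ZMod.intCast_zmod_eq_zero_iff_dvd]
    push_cast
    rw [hv, hw, ZMod.natCast_zmod_val, ZMod.natCast_zmod_val]
    ring
  have hzero : (a - b) - ((v : ℤ) - w) = 0 :=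
    Int.eq_zero_of_abs_lt_dvd hdvd (by have := abs_sub (a - b) ((v : ℤ) - w); omega)
  rw [show a - b = (v : ℤ) - w by omega] at hab
  omega

end Block

/-- A phase point is a position on a cycle of length `L` together with `J` families of signs, the
signs of each family being indexed by the blocks of the cycle. -/
abbrev Phase (L J : ℕ) : Type := ZMod L × (Fin J → Fin L → ℤˣ)

/-- The rotation of the cycle by one step. -/
def shift (L J : ℕ) : Equiv.Perm (Phase L J) :=
  (Equiv.addRight 1).prodCongr (Equiv.refl _)

lemma shift_zpow_apply {L J : ℕ} (k : ℤ) (x : Phase L J) :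
    (shift L J ^ k) x = (x.1 + k, x.2) := by
  induction k using Int.induction_on generalizing x with
  | zero => simp
  | succ k ih =>
    rw [zpow_add_one, Equiv.Perm.mul_apply, ih]
    simp [shift, add_assoc, add_comm (1 : ZMod L)]
  | pred k ih =>
    have hinv : (shift L J)⁻¹ x = (x.1 - 1, x.2) := by
      rw [Equiv.Perm.inv_eq_iff_eq]
      simp [shift]
    rw [zpow_sub_one, Equiv.Perm.mul_apply, ih, hinv]
    push_cast
    rw [sub_add_eq_add_sub, add_sub_assoc]

/-- The signs attached to the blocks at the position of a phase point: the `j`-th one is constant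
on blocks of length `M j`, so that it varies slowly if `M j` is large. -/
def phaseSign {L J : ℕ} [NeZero L] (M : Fin J → ℕ) (x : Phase L J) : Fin J → ℤˣ :=
  fun j => x.2 j (block (M j) x.1)

section Phase

variable {L J : ℕ} [NeZero L] {M : Fin J → ℕ}

lemma dens_phaseSign_mem (s : Finset (Fin J → ℤˣ)) :
    ({x : Phase L J | phaseSign M x ∈ s} : Finset (Phase L J)).dens = s.dens := by
  have hequi := expect_comp_of_equivariant (Ω := Phase L J)
    (fun ε => (Equiv.refl _).prodCongr (Equiv.mulLeft fun j _ => ε j)) (phaseSign M)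
    (fun _ _ => rfl) fun ε => if ε ∈ s then 1 else 0
  rw [expect_ite_one_zero, expect_ite_one_zero, filter_univ_mem] at hequi
  exact_mod_cast hequi

lemma dens_phaseSign_shift_ne_le {j : Fin J} (hM : 0 < M j) (hML : M j ≤ L) :
    (({x | phaseSign M (shift L J x) j ≠ phaseSign M x j} : Finset (Phase L J)).dens : ℝ) ≤
      2 / M j := by
  have hsub : ({x | phaseSign M (shift L J x) j ≠ phaseSign M x j} : Finset (Phase L J)) ⊆
      ({m | block (M j) (m + 1) ≠ block (M j) m} : Finset (ZMod L)) ×ˢ univ := fun x hx => by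
    simp only [mem_product, mem_filter_univ, mem_univ, and_true] at hx ⊢
    exact fun hblock => hx (congrArg (x.2 j) hblock)
  have hprod := dens_le_dens hsub
  rw [dens_product_univ] at hprod
  exact le_trans (by exact_mod_cast hprod) (dens_block_add_one_ne_le hM hML)

lemma dens_phaseSign_shift_zpow_ne_le {j : Fin J} (hM : 0 < M j) (hML : M j ≤ L) (k : ℤ) :
    (({x | phaseSign M ((shift L J ^ k) x) j ≠ phaseSign M x j} : Finset (Phase L J)).dens : ℝ) ≤
      k.natAbs * (2 / M j) :=
  (dens_comp_zpow_ne_le (shift L J) (fun x => phaseSign M x j) k).trans <| by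
    gcongr
    exact dens_phaseSign_shift_ne_le hM hML

/-- Flips the `i`-th sign on the block at distance `a` from the current position. -/
def phaseFlip (M : Fin J → ℕ) (i : Fin J) (a : ℤ) : Equiv.Perm (Phase L J) :=
  Equiv.prodShear (Equiv.refl _) fun m =>
    Equiv.mulLeft (Pi.mulSingle i (Pi.mulSingle (block (M i) (m + a)) (-1)))

lemma phaseSign_shift_zpow_phaseFlip (i : Fin J) (a : ℤ) (x : Phase L J) :
    phaseSign M ((shift L J ^ a) (phaseFlip M i a x)) =
      Pi.mulSingle i (-1) * phaseSign M ((shift L J ^ a) x) := by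
  ext j
  rcases eq_or_ne j i with rfl | hj
  · simp [shift_zpow_apply, phaseSign, phaseFlip]
  · simp [shift_zpow_apply, phaseSign, phaseFlip, hj]

lemma phaseSign_shift_zpow_phaseFlip_of_block_ne {i : Fin J} {a b : ℤ} {x : Phase L J}
    (h : block (M i) (x.1 + (a : ZMod L)) ≠ block (M i) (x.1 + (b : ZMod L))) :
    phaseSign M ((shift L J ^ b) (phaseFlip M i a x)) = phaseSign M ((shift L J ^ b) x) := by
  ext j
  rcases eq_or_ne j i with rfl | hj
  · simp [shift_zpow_apply, phaseSign, phaseFlip, h.symm]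
  · simp [shift_zpow_apply, phaseSign, phaseFlip, hj]

lemma expect_inner_comp_phaseSign_eq_zero {i : Fin J} (hM : 0 < M i) {g : (Fin J → ℤˣ) → ℂ}
    (hg : ∀ ε, g (Pi.mulSingle i (-1) * ε) = -g ε) {a b : ℤ} (hab : (M i : ℤ) ≤ |a - b|)
    (hL : |a - b| + M i ≤ L) :
    𝔼 x : Phase L J, inner ℝ (g (phaseSign M ((shift L J ^ a) x)))
      (g (phaseSign M ((shift L J ^ b) x))) = 0 :=
  expect_eq_zero_of_comp_eq_neg (phaseFlip M i a) fun x => by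
    rw [phaseSign_shift_zpow_phaseFlip, hg, inner_neg_left,
      phaseSign_shift_zpow_phaseFlip_of_block_ne (block_add_ne_of_le hM x.1 hab hL)]

end Phase

/-! ### Polynomial averages -/

lemma norm_expect_sq_eq_expect_inner {ι : Type*} (s : Finset ι) (f : ι → ℂ) :
    ‖𝔼 i ∈ s, f i‖ ^ 2 = 𝔼 i ∈ s, 𝔼 j ∈ s, inner ℝ (f i) (f j) := by
  have hsmul : 𝔼 i ∈ s, f i = (#s : ℝ)⁻¹ • ∑ i ∈ s, f i := by
    rw [expect_eq_sum_div_card, Complex.real_smul, div_eq_inv_mul]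
    push_cast
    rfl
  simp only [← real_inner_self_eq_norm_sq, hsmul, inner_smul_left, inner_smul_right, sum_inner,
    inner_sum, expect_eq_sum_div_card, ← sum_div, conj_trivial, ← mul_sum]
  rw [sum_comm]
  ring

lemma card_eval_close_le {P : Polynomial ℤ} (hP : 0 < P.natDegree) (N M : ℕ) (c : ℤ) :
    #{n ∈ Icc 1 N | |c - P.eval ((n : ℕ) : ℤ)| < M} ≤ P.natDegree * (2 * M) := by
  have hfiber (v : ℤ) :
      #{n ∈ ({n ∈ Icc 1 N | |c - P.eval (n : ℤ)| < M} : Finset ℕ) | P.eval ((n : ℕ) : ℤ) = v} ≤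
        P.natDegree := by
    have hdeg : 0 < P.degree := Polynomial.natDegree_pos_iff_degree_pos.1 hP
    refine (card_le_card_of_injOn (t := (P - Polynomial.C v).roots.toFinset) (fun n : ℕ => (n : ℤ))
      (fun n hn => ?_) Nat.cast_injective.injOn).trans
      ((Multiset.toFinset_card_le _).trans (Polynomial.card_roots_sub_C' hdeg))
    rw [mem_coe, Multiset.mem_toFinset, Polynomial.mem_roots_sub_C hdeg]
    exact (mem_filter.1 hn).2
  have hmaps : ∀ n ∈ ({n ∈ Icc 1 N | |c - P.eval (n : ℤ)| < M} : Finset ℕ),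
      P.eval (n : ℤ) ∈ Ico (c - M) (c + M) := fun n hn => by
    have := abs_lt.1 (mem_filter.1 hn).2
    rw [mem_Ico]
    omega
  refine (card_le_mul_card_image_of_maps_to hmaps _ fun v _ => hfiber v).trans ?_
  rw [Int.card_Ico]
  gcongr
  omega

section PolyAverage

variable {X : Type*} (T : Equiv.Perm X) (P : Polynomial ℤ) (N : ℕ+)

lemma polyAverage_eq_expect (f : X → ℂ) (x : X) :
    polyAverage T P f N x = 𝔼 n ∈ Icc 1 (N : ℕ), f ((T ^ P.eval (n : ℤ)) x) := by
  rw [polyAverage, expect_eq_sum_div_card, Nat.card_Icc, add_tsub_cancel_right, one_div_mul_eq_div]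

lemma polyAverage_sub (f g : X → ℂ) (x : X) :
    polyAverage T P (fun y => f y - g y) N x =
      polyAverage T P f N x - polyAverage T P g N x := by
  simp only [polyAverage_eq_expect, expect_sub_distrib]

variable [Fintype X]

lemma expect_norm_polyAverage_sub_sq_le {f g : X → ℂ} {δ : ℝ}
    (h : ∀ n ∈ Icc 1 (N : ℕ), 𝔼 x, ‖f ((T ^ P.eval (n : ℤ)) x) - g x‖ ^ 2 ≤ δ) :
    𝔼 x, ‖polyAverage T P f N x - g x‖ ^ 2 ≤ δ := by
  have hN : (Icc 1 (N : ℕ)).Nonempty := nonempty_Icc.2 N.2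
  calc 𝔼 x, ‖polyAverage T P f N x - g x‖ ^ 2
      ≤ 𝔼 x, 𝔼 n ∈ Icc 1 (N : ℕ), ‖f ((T ^ P.eval (n : ℤ)) x) - g x‖ ^ 2 := by
        refine expect_le_expect fun x _ => ?_
        rw [polyAverage_eq_expect, ← expect_const hN (g x), ← expect_sub_distrib]
        simpa only [expect_const hN] using norm_expect_sq_le _ _
    _ = 𝔼 n ∈ Icc 1 (N : ℕ), 𝔼 x, ‖f ((T ^ P.eval (n : ℤ)) x) - g x‖ ^ 2 := expect_comm ..
    _ ≤ δ := expect_le hN h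

variable {P} [Nonempty X]

/-- Only the pairs `n, n'` with `|P(n) - P(n')| < M` contribute to the second moment. -/
lemma expect_norm_polyAverage_sq_le_of_uncorrelated (hP : 0 < P.natDegree) {f : X → ℂ} {b : ℝ}
    (hf : ∀ x, ‖f x‖ ≤ b) {M : ℕ}
    (hcorr : ∀ n ∈ Icc 1 (N : ℕ), ∀ n' ∈ Icc 1 (N : ℕ),
      (M : ℤ) ≤ |P.eval (n : ℤ) - P.eval (n' : ℤ)| →
        𝔼 x, inner ℝ (f ((T ^ P.eval (n : ℤ)) x)) (f ((T ^ P.eval (n' : ℤ)) x)) = 0) :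
    𝔼 x, ‖polyAverage T P f N x‖ ^ 2 ≤ 2 * b ^ 2 * P.natDegree * M / N := by
  have hinner (u v : X) : inner ℝ (f u) (f v) ≤ b ^ 2 := by
    rw [sq]
    exact (real_inner_le_norm _ _).trans
      (mul_le_mul (hf u) (hf v) (norm_nonneg _) ((norm_nonneg _).trans (hf u)))
  have hrow : ∀ n ∈ Icc 1 (N : ℕ), 𝔼 n' ∈ Icc 1 (N : ℕ), 𝔼 x,
      inner ℝ (f ((T ^ P.eval (n : ℤ)) x)) (f ((T ^ P.eval (n' : ℤ)) x)) ≤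
        2 * b ^ 2 * P.natDegree * M / N := fun n hn => by
    rw [expect_eq_sum_div_card, Nat.card_Icc, add_tsub_cancel_right]
    gcongr
    calc _ ≤ ∑ n' ∈ Icc 1 (N : ℕ),
          if |P.eval (n : ℤ) - P.eval (n' : ℤ)| < M then b ^ 2 else 0 := by
          refine sum_le_sum fun n' hn' => ?_
          split_ifs with hclose
          · exact expect_le univ_nonempty fun x _ => hinner _ _
          · exact (hcorr n hn n' hn' (not_lt.1 hclose)).le
      _ = #{n' ∈ Icc 1 (N : ℕ) | |P.eval (n : ℤ) - P.eval ((n' : ℕ) : ℤ)| < M} * b ^ 2 := by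
          rw [← sum_filter, sum_const, nsmul_eq_mul]
      _ ≤ (P.natDegree * (2 * M) : ℕ) * b ^ 2 := by
          gcongr
          exact card_eval_close_le hP N M _
      _ = 2 * b ^ 2 * P.natDegree * M := by push_cast; ring
  calc 𝔼 x, ‖polyAverage T P f N x‖ ^ 2
      = 𝔼 n ∈ Icc 1 (N : ℕ), 𝔼 n' ∈ Icc 1 (N : ℕ), 𝔼 x,
          inner ℝ (f ((T ^ P.eval (n : ℤ)) x)) (f ((T ^ P.eval (n' : ℤ)) x)) := by
        simp only [polyAverage_eq_expect, norm_expect_sq_eq_expect_inner]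
        rw [expect_comm]
        exact expect_congr rfl fun n _ => expect_comm ..
    _ ≤ 2 * b ^ 2 * P.natDegree * M / N := expect_le (nonempty_Icc.2 N.2) hrow

end PolyAverage

/-! ### Averages along separated scales -/

lemma expect_norm_sub_sq_le_mul_dens {X : Type*} [Fintype X] {f g : X → ℂ}
    (hf : ∀ x, ‖f x‖ ≤ 1) (hg : ∀ x, ‖g x‖ ≤ 1) :
    𝔼 x, ‖f x - g x‖ ^ 2 ≤ 4 * ({x | f x ≠ g x} : Finset X).dens := by
  refine expect_le_mul_dens (fun x _ => ?_) fun x hx => ?_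
  · calc ‖f x - g x‖ ^ 2 ≤ (1 + 1) ^ 2 := by
          gcongr
          exact (norm_sub_le _ _).trans (add_le_add (hf x) (hg x))
      _ = 4 := by norm_num
  · simp [not_not.1 hx]

lemma norm_sum_add_sq_le {ι E : Type*} [SeminormedAddCommGroup E] (s : Finset ι) (f : ι → E)
    (e : E) : ‖∑ i ∈ s, f i + e‖ ^ 2 ≤ 2 * (#s * ∑ i ∈ s, ‖f i‖ ^ 2 + ‖e‖ ^ 2) := by
  calc ‖∑ i ∈ s, f i + e‖ ^ 2 ≤ (∑ i ∈ s, ‖f i‖ + ‖e‖) ^ 2 := by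
        gcongr
        exact (norm_add_le _ _).trans (by gcongr; exact norm_sum_le _ _)
    _ ≤ 2 * ((∑ i ∈ s, ‖f i‖) ^ 2 + ‖e‖ ^ 2) := add_sq_le
    _ ≤ 2 * (#s * ∑ i ∈ s, ‖f i‖ ^ 2 + ‖e‖ ^ 2) := by
        gcongr
        exact sq_sum_le_card_mul_sum_sq

section Phase

variable {L J : ℕ} [NeZero L] {M : Fin J → ℕ}

lemma dens_comp_phaseSign_shift_zpow_ne_le {α : Type*} [DecidableEq α] {g : (Fin J → ℤˣ) → α}
    {s : Finset (Fin J)} (hg : DependsOn g s) (hM : ∀ j ∈ s, 0 < M j) (hML : ∀ j ∈ s, M j ≤ L)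
    {k : ℤ} {δ : ℝ} (hδ : ∀ j ∈ s, k.natAbs * (2 / M j) ≤ δ) :
    (({x | g (phaseSign M ((shift L J ^ k) x)) ≠ g (phaseSign M x)} :
      Finset (Phase L J)).dens : ℝ) ≤ #s * δ := by
  have hsub : ({x | g (phaseSign M ((shift L J ^ k) x)) ≠ g (phaseSign M x)} :
      Finset (Phase L J)) ⊆
      s.biUnion fun j => {x | phaseSign M ((shift L J ^ k) x) j ≠ phaseSign M x j} := fun x hx => by
    simp only [mem_biUnion, mem_filter_univ] at hx ⊢
    by_contra! h
    exact hx (hg h)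
  calc _ ≤ ((∑ j ∈ s, ({x | phaseSign M ((shift L J ^ k) x) j ≠ phaseSign M x j} :
        Finset (Phase L J)).dens : ℚ≥0) : ℝ) := by
        exact_mod_cast (dens_le_dens hsub).trans dens_biUnion_le
    _ ≤ ∑ _j ∈ s, δ := by
        rw [NNRat.cast_sum]
        exact sum_le_sum fun j hj =>
          (dens_phaseSign_shift_zpow_ne_le (hM j hj) (hML j hj) k).trans (hδ j hj)
    _ = #s * δ := by rw [sum_const, nsmul_eq_mul]

end Phase

/-- Times `N i` and block lengths `M j`, interlaced as `N 0 ≪ M 0 ≪ N 1 ≪ M 1 ≪ ⋯ ≪ L`: up to an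
error of size `1 / K`, the orbits along `P` up to time `N i` stay in one block of length `M j` if
`i ≤ j`, and equidistribute among many such blocks if `j < i`. -/
structure IsSeparated {J : ℕ} (P : Polynomial ℤ) (K : ℕ) (N : ℕ → ℕ+) (M : Fin J → ℕ) (L : ℕ) :
    Prop where
  pos (j : Fin J) : 0 < M j
  slow {i : ℕ} {j : Fin J} (hij : i ≤ j) : ∀ n ∈ Icc 1 (N i : ℕ),
    K * (P.eval (n : ℤ)).natAbs ≤ M j
  fast {i : ℕ} {j : Fin J} (hji : j < i) : K * M j ≤ N i
  room {i : ℕ} (hi : i ≤ J) (j : Fin J) : ∀ n ∈ Icc 1 (N i : ℕ), ∀ n' ∈ Icc 1 (N i : ℕ),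
    |P.eval (n : ℤ) - P.eval (n' : ℤ)| + M j ≤ L

namespace IsSeparated

variable {J K L : ℕ} {P : Polynomial ℤ} {N : ℕ → ℕ+} {M : Fin J → ℕ}

lemma le_length (h : IsSeparated P K N M L) (j : Fin J) : M j ≤ L := by
  have hone : 1 ∈ Icc 1 (N 0 : ℕ) := mem_Icc.2 ⟨le_rfl, (N 0).2⟩
  simpa using h.room J.zero_le j 1 hone 1 hone

variable [NeZero L] {G : ℕ → (Fin J → ℤˣ) → ℂ}

lemma expect_norm_polyAverage_sub_self_sq_le (h : IsSeparated P K N M L) (hK : 0 < K)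
    (hG : IsReverseSignMartingale G) (hG1 : ∀ i x, ‖G i x‖ ≤ 1) (i : ℕ) :
    𝔼 x : Phase L J, ‖polyAverage (shift L J) P (fun y => G i (phaseSign M y)) (N i) x -
      G i (phaseSign M x)‖ ^ 2 ≤ 8 * J / K := by
  refine expect_norm_polyAverage_sub_sq_le _ _ _ fun n hn => ?_
  have hδ : ∀ j ∈ ({j | i ≤ j} : Finset (Fin J)),
      ((P.eval (n : ℤ)).natAbs : ℝ) * (2 / M j) ≤ 2 / K := fun j hj => by
    have hslow : (K : ℝ) * (P.eval (n : ℤ)).natAbs ≤ M j := by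
      exact_mod_cast h.slow (mem_filter_univ j |>.1 hj) n hn
    have hMj : (0 : ℝ) < M j := by exact_mod_cast h.pos j
    rw [← mul_div_assoc, div_le_div_iff₀ hMj (by exact_mod_cast hK)]
    linarith
  have hdep : DependsOn (G i) (({j | i ≤ j} : Finset (Fin J)) : Set (Fin J)) := by
    simpa using hG.dependsOn i
  have hcard : #({j | i ≤ j} : Finset (Fin J)) ≤ J := (card_le_univ _).trans (Fintype.card_fin J).le
  calc _ ≤ 4 * (({x | G i (phaseSign M ((shift L J ^ P.eval (n : ℤ)) x)) ≠
          G i (phaseSign M x)} : Finset (Phase L J)).dens : ℝ) :=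
        expect_norm_sub_sq_le_mul_dens (fun _ => hG1 i _) fun _ => hG1 i _
    _ ≤ 4 * (J * (2 / K)) := by
        gcongr
        refine (dens_comp_phaseSign_shift_zpow_ne_le hdep (fun j _ => h.pos j)
          (fun j _ => h.le_length j) hδ).trans ?_
        gcongr
    _ = 8 * J / K := by ring

lemma expect_norm_polyAverage_sub_succ_sq_le (h : IsSeparated P K N M L) (hK : 0 < K)
    (hP : 0 < P.natDegree) (hG : IsReverseSignMartingale G) (hG1 : ∀ i x, ‖G i x‖ ≤ 1) {i : ℕ}
    (hi : i ≤ J) {j : Fin J} (hj : j < i) :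
    𝔼 x : Phase L J, ‖polyAverage (shift L J) P
      (fun y => G j (phaseSign M y) - G (j + 1) (phaseSign M y)) (N i) x‖ ^ 2 ≤
        8 * P.natDegree / K := by
  have hnorm (x : Phase L J) : ‖G j (phaseSign M x) - G (j + 1) (phaseSign M x)‖ ≤ 2 :=
    (norm_sub_le _ _).trans (by linarith [hG1 j (phaseSign M x), hG1 (j + 1) (phaseSign M x)])
  refine (expect_norm_polyAverage_sq_le_of_uncorrelated _ (N i) hP hnorm (M := M j)
    fun n hn n' hn' hfar => expect_inner_comp_phaseSign_eq_zero
      (g := fun ε => G j ε - G (j + 1) ε) (h.pos j) (fun ε => hG.sub_succ_mulSingle_mul j ε) hfar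
      (h.room hi j n hn n' hn')).trans ?_
  have hfast : (K : ℝ) * M j ≤ N i := by exact_mod_cast h.fast hj
  rw [div_le_div_iff₀ (by exact_mod_cast (N i).pos) (by exact_mod_cast hK)]
  calc 2 * 2 ^ 2 * P.natDegree * M j * K = 8 * P.natDegree * (K * M j : ℝ) := by ring
    _ ≤ 8 * P.natDegree * N i := by gcongr

/-- The average at time `N i` of the martingale difference `G j - G (j + 1)` is negligible for
`j < i`, and averaging `G i` hardly changes it. -/
lemma expect_norm_polyAverage_sub_sq_le (h : IsSeparated P K N M L) (hK : 0 < K)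
    (hP : 0 < P.natDegree) (hG : IsReverseSignMartingale G) (hG1 : ∀ i x, ‖G i x‖ ≤ 1) {i : ℕ}
    (hi : i ≤ J) :
    𝔼 x : Phase L J, ‖polyAverage (shift L J) P (fun y => G 0 (phaseSign M y)) (N i) x -
      G i (phaseSign M x)‖ ^ 2 ≤ 16 * (J + 1) ^ 2 * (P.natDegree + 1) / K := by
  set A : ℕ → Phase L J → ℂ := fun j => polyAverage (shift L J) P
    (fun y => G j (phaseSign M y) - G (j + 1) (phaseSign M y)) (N i)
  set R : Phase L J → ℂ := fun x => polyAverage (shift L J) P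
    (fun y => G i (phaseSign M y)) (N i) x - G i (phaseSign M x)
  have hpoint (x : Phase L J) : ‖polyAverage (shift L J) P (fun y => G 0 (phaseSign M y)) (N i) x -
      G i (phaseSign M x)‖ ^ 2 ≤ 2 * (i * ∑ j ∈ range i, ‖A j x‖ ^ 2 + ‖R x‖ ^ 2) := by
    have htelescope : polyAverage (shift L J) P (fun y => G 0 (phaseSign M y)) (N i) x -
        G i (phaseSign M x) = ∑ j ∈ range i, A j x + R x := by
      simp only [A, R, polyAverage_sub]
      rw [sum_range_sub' fun j => polyAverage (shift L J) P (fun y => G j (phaseSign M y)) (N i) x]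
      ring
    rw [htelescope]
    simpa using norm_sum_add_sq_le (range i) (fun j => A j x) (R x)
  have hA : ∀ j ∈ range i, 𝔼 x, ‖A j x‖ ^ 2 ≤ 8 * P.natDegree / K := fun j hj =>
    h.expect_norm_polyAverage_sub_succ_sq_le hK hP hG hG1 hi
      (j := ⟨j, (mem_range.1 hj).trans_le hi⟩) (mem_range.1 hj)
  have hR : 𝔼 x, ‖R x‖ ^ 2 ≤ 8 * J / K :=
    h.expect_norm_polyAverage_sub_self_sq_le hK hG hG1 i
  calc _ ≤ 2 * (i * ∑ j ∈ range i, 𝔼 x, ‖A j x‖ ^ 2 + 𝔼 x, ‖R x‖ ^ 2) := by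
        rw [← expect_sum_comm, mul_expect, ← expect_add_distrib, mul_expect]
        exact expect_le_expect fun x _ => hpoint x
    _ ≤ 2 * (J * (J * (8 * P.natDegree / K)) + 8 * J / K) := by
        have hsum := sum_le_card_nsmul _ _ _ hA
        rw [card_range, nsmul_eq_mul] at hsum
        have hiJ : (i : ℝ) ≤ J := by exact_mod_cast hi
        gcongr
        exact hsum.trans (by gcongr)
    _ = 16 * (J ^ 2 * P.natDegree + J) / K := by ring
    _ ≤ 16 * (J + 1) ^ 2 * (P.natDegree + 1) / K := by
        rw [mul_assoc]
        gcongr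
        nlinarith [show (0 : ℝ) ≤ J * P.natDegree by positivity, sq_nonneg (J : ℝ)]

end IsSeparated

/-- A bound for the values of a polynomial at `1, …, N` that is positive and monotone in `N`. -/
def evalBound (P : Polynomial ℤ) (N : ℕ) : ℕ := 1 + ∑ n ∈ Icc 1 N, (P.eval (n : ℤ)).natAbs

lemma monotone_evalBound (P : Polynomial ℤ) : Monotone (evalBound P) := fun a b hab => by
  unfold evalBound
  gcongr

lemma natAbs_eval_le_evalBound (P : Polynomial ℤ) {N n : ℕ} (hn : n ∈ Icc 1 N) :
    (P.eval (n : ℤ)).natAbs ≤ evalBound P N :=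
  (single_le_sum (f := fun n : ℕ => (P.eval (n : ℤ)).natAbs) (fun _ _ => Nat.zero_le _) hn).trans
    (Nat.le_add_left _ _)

lemma exists_sparse_seq {I : Set ℕ+} (hI : I.Infinite) (φ : ℕ+ → ℕ) :
    ∃ N : ℕ → I, StrictMono N ∧ ∀ i j, i < j → φ (N i) ≤ ((N j : ℕ+) : ℕ) := by
  obtain ⟨N, hNI, hN⟩ := exists_seq_of_forall_finset_exists (· ∈ I)
    (fun a b => a < b ∧ φ a ≤ (b : ℕ)) fun s _ => by
      obtain ⟨b, hb, hlt⟩ := hI.exists_gt (Nat.succPNat (∑ a ∈ s, ((a : ℕ) + φ a)))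
      refine ⟨b, hb, fun a ha => ?_⟩
      have hle := single_le_sum (f := fun a : ℕ+ => (a : ℕ) + φ a) (fun _ _ => Nat.zero_le _) ha
      have hlt' : (∑ a ∈ s, ((a : ℕ) + φ a)) + 1 < (b : ℕ) := hlt
      rw [← PNat.coe_lt_coe]
      omega
  exact ⟨fun i => ⟨N i, hNI i⟩, fun i j hij => (hN i j hij).1, fun i j hij => (hN i j hij).2⟩

lemma exists_isSeparated (P : Polynomial ℤ) {I : Set ℕ+} (hI : I.Infinite) (J : ℕ) {K : ℕ}
    (hK : 0 < K) : ∃ (N : ℕ → I) (M : Fin J → ℕ) (L : ℕ) (_ : NeZero L),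
      Monotone N ∧ IsSeparated P K (fun i => N i) M L := by
  obtain ⟨N, hN, hsparse⟩ := exists_sparse_seq hI fun n => K * (K * evalBound P n)
  have hbound {i j : ℕ} (hij : i ≤ j) : evalBound P (N i : ℕ+) ≤ evalBound P (N j : ℕ+) :=
    monotone_evalBound P (hN.monotone hij)
  have hpos (n : ℕ) : 0 < evalBound P n := Nat.add_pos_left one_pos _
  refine ⟨N, fun j => K * evalBound P (N j : ℕ+), (2 + K) * evalBound P (N J : ℕ+),
    ⟨(Nat.mul_pos (by omega) (hpos _)).ne'⟩, hN.monotone, ?_⟩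
  constructor
  case pos => exact fun j => Nat.mul_pos hK (hpos _)
  case slow =>
    intro i j hij n hn
    gcongr
    exact (natAbs_eval_le_evalBound P hn).trans (hbound hij)
  case fast => exact fun hji => hsparse _ _ hji
  case room =>
    intro i hi j n hn n' hn'
    have hn := natAbs_eval_le_evalBound P hn
    have hn' := natAbs_eval_le_evalBound P hn'
    have hi := hbound hi
    have hj : K * evalBound P (N j : ℕ+) ≤ K * evalBound P (N J : ℕ+) :=
      Nat.mul_le_mul_left K (hbound j.2.le)
    have hsub := abs_sub (P.eval (n : ℤ)) (P.eval (n' : ℤ))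
    rw [add_mul]
    push_cast at hj ⊢
    zify at *
    linarith

lemma exists_polyAverage_close {P : Polynomial ℤ} (hP : 0 < P.natDegree) {I : Set ℕ+}
    (hI : I.Infinite) {J : ℕ} {G : ℕ → (Fin J → ℤˣ) → ℂ} (hG : IsReverseSignMartingale G)
    (hG1 : ∀ i x, ‖G i x‖ ≤ 1) {η : ℝ} (hη : 0 < η) :
    ∃ (N : ℕ → I) (M : Fin J → ℕ) (L : ℕ) (_ : NeZero L) (s : Finset (Phase L J)),
      Monotone N ∧ (s.dens : ℝ) ≤ 1 / 4 ∧ ∀ x ∉ s, ∀ i ≤ J,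
        ‖polyAverage (shift L J) P (fun y => G 0 (phaseSign M y)) (N i) x -
          G i (phaseSign M x)‖ ≤ η := by
  obtain ⟨K, hK⟩ := exists_nat_gt
    (4 * ((J + 1) * (16 * (J + 1) ^ 2 * (P.natDegree + 1) / η ^ 2)) : ℝ)
  have hK0 : (0 : ℝ) < K := lt_of_le_of_lt (by positivity) hK
  obtain ⟨N, M, L, hL, hN, hsep⟩ := exists_isSeparated P hI J (Nat.cast_pos.1 hK0)
  let D (i : ℕ) (x : Phase L J) : ℝ := ‖polyAverage (shift L J) P
    (fun y => G 0 (phaseSign M y)) (N i) x - G i (phaseSign M x)‖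
  let s (i : ℕ) : Finset (Phase L J) := {x | η ^ 2 ≤ D i x ^ 2}
  have hmarkov : ∀ i ∈ range (J + 1),
      ((s i).dens : ℝ) ≤ 16 * (J + 1) ^ 2 * (P.natDegree + 1) / η ^ 2 / K := fun i hi => by
    rw [div_right_comm, le_div_iff₀' (by positivity)]
    exact (mul_dens_le_expect (fun x => sq_nonneg (D i x)) (η ^ 2)).trans
      (hsep.expect_norm_polyAverage_sub_sq_le (Nat.cast_pos.1 hK0) hP hG hG1
        (mem_range_succ_iff.1 hi))
  refine ⟨N, M, L, hL, (range (J + 1)).biUnion s, hN, ?_, fun x hx i hi => ?_⟩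
  · calc _ ≤ ((∑ i ∈ range (J + 1), (s i).dens : ℚ≥0) : ℝ) := by exact_mod_cast dens_biUnion_le
      _ ≤ (J + 1) * (16 * (J + 1) ^ 2 * (P.natDegree + 1) / η ^ 2 / K) := by
          rw [NNRat.cast_sum]
          simpa using sum_le_card_nsmul _ _ _ hmarkov
      _ ≤ 1 / 4 := by
          rw [← mul_div_assoc, div_le_div_iff₀ hK0 four_pos]
          linarith
  · have hxi : x ∉ s i := fun h => hx (mem_biUnion.2 ⟨i, mem_range_succ_iff.2 hi, h⟩)
    rw [mem_filter_univ, not_le] at hxi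
    exact (lt_of_pow_lt_pow_left₀ 2 hη.le hxi).le

/-! ### Large variation on finite and on probability spaces -/

lemma exists_perm_rVariation_polyAverage_ge {P : Polynomial ℤ} (hP : 0 < P.natDegree)
    {I : Set ℕ+} (hI : I.Infinite) (r : ℕ) :
    ∃ (X : Type) (_ : Fintype X) (_ : Nonempty X) (T : Equiv.Perm X) (f : X → ℂ) (s : Finset X),
      (∀ x, ‖f x‖ ≤ 1) ∧ (s.dens : ℝ) ≤ 2⁻¹ ∧
        ∀ x ∉ s, (r : ℝ≥0∞) ≤ rVariation 2 fun N : I => polyAverage T P f N x := by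
  obtain ⟨J, G, η, hη, hG, hG1, s, hs, hvar⟩ := exists_martingale_large_variation r
  obtain ⟨N, M, L, _, s', hN, hs', hclose⟩ := exists_polyAverage_close hP hI hG hG1 hη
  let b : Finset (Phase L J) := {x | phaseSign M x ∈ s}
  have hb : b.dens = s.dens := dens_phaseSign_mem s
  refine ⟨Phase L J, inferInstance, inferInstance, shift L J, fun y => G 0 (phaseSign M y), b ∪ s',
    fun _ => hG1 0 _, ?_, fun x hx => ?_⟩
  · have hunion : ((b ∪ s').dens : ℝ) ≤ s.dens + s'.dens := by
      exact_mod_cast hb ▸ dens_union_le b s'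
    linarith
  · obtain ⟨hxb, hxs'⟩ := notMem_union.1 hx
    have hxs : phaseSign M x ∉ s := fun h => hxb ((mem_filter_univ x).2 h)
    exact (hvar _ hxs (fun i => polyAverage (shift L J) P (fun y => G 0 (phaseSign M y)) (N i) x)
      (hclose x hxs')).trans (rVariation_comp_le 2
        (fun n : I => polyAverage (shift L J) P (fun y => G 0 (phaseSign M y)) n x) hN)

section Measure

variable {X : Type*} [MeasurableSpace X]

lemma measurePreserving_uniformOn_univ (T : X ≃ᵐ X) :
    MeasurePreserving T (ProbabilityTheory.uniformOn Set.univ)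
      (ProbabilityTheory.uniformOn Set.univ) := by
  have hcount : MeasurePreserving T Measure.count Measure.count :=
    ⟨T.measurable, Measure.ext fun s hs => by
      rw [Measure.map_apply T.measurable hs, Measure.count_apply hs,
        Measure.count_apply (T.measurable hs), ← T.image_symm, T.symm.injective.encard_image]⟩
  rw [ProbabilityTheory.uniformOn, ProbabilityTheory.cond, Measure.restrict_univ]
  exact hcount.smul_measure _

lemma uniformOn_univ_apply_finset [Fintype X] [MeasurableSingletonClass X] (s : Finset X) :
    ProbabilityTheory.uniformOn Set.univ (s : Set X) = ENNReal.ofReal s.dens := by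
  cases isEmpty_or_nonempty X
  · simp [Subsingleton.elim s ∅]
  rw [ProbabilityTheory.uniformOn_univ, Measure.count_apply_finset, nnratCast_dens,
    ENNReal.ofReal_div_of_pos (Nat.cast_pos.2 Fintype.card_pos), ENNReal.ofReal_natCast,
    ENNReal.ofReal_natCast]

lemma mul_measure_rpow_le_eLpNorm {μ : Measure X} {p : ℝ≥0∞} (hp : p ≠ 0) {s : Set X}
    (hs : MeasurableSet s) (hμs : μ s ≠ 0) {f : X → ℝ≥0∞} {c : ℝ≥0∞} (hf : ∀ x ∈ s, c ≤ f x) :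
    c * μ s ^ (1 / p.toReal) ≤ eLpNorm f p μ := by
  calc c * μ s ^ (1 / p.toReal) = eLpNorm (s.indicator fun _ => c) p μ :=
        (eLpNorm_indicator_const' (c := c) hs hμs hp).symm
    _ ≤ eLpNorm f p μ := eLpNorm_mono_enorm fun x => by
        by_cases hx : x ∈ s <;> simp [hx, hf]

end Measure

end ErgodicVariation

open ErgodicVariation in
theorem mainTheorem7 (P : Polynomial ℤ) (hP : 0 < P.natDegree) (p : ℝ≥0∞) (hp : 0 < p)
    (I : Set ℕ+) (hI : I.Infinite) (C : ℝ≥0) :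
    ∃ (X : Type) (_ : MeasurableSpace X) (μ : Measure X) (T : X ≃ᵐ X),
      IsProbabilityMeasure μ ∧ MeasurePreserving T μ μ ∧
      ∃ f : X → ℂ, MemLp f ∞ μ ∧ eLpNorm f ∞ μ ≤ 1 ∧
        (C : ℝ≥0∞) < eLpVariation (fun N : I => polyAverage T.toEquiv P f (N : ℕ+)) p 2 μ := by
  have hhalf : (2⁻¹ : ℝ≥0∞) ^ (1 / p.toReal) ≠ 0 := by simp
  obtain ⟨r, hr⟩ := ENNReal.exists_nat_mul_gt hhalf (ENNReal.coe_ne_top (r := C))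
  obtain ⟨X, _, _, T, f, s, hf, hs, hvar⟩ := exists_perm_rVariation_polyAverage_ge hP hI r
  let _ : MeasurableSpace X := ⊤
  let μ : Measure X := ProbabilityTheory.uniformOn Set.univ
  have hμs : 2⁻¹ ≤ μ (s : Set X)ᶜ := by
    rw [prob_compl_eq_one_sub s.measurableSet, uniformOn_univ_apply_finset,
      ← ENNReal.one_sub_inv_two]
    gcongr
    simpa using ENNReal.ofReal_le_ofReal hs
  have hf' : ∀ᵐ x ∂μ, ‖f x‖ ≤ 1 := .of_forall hf
  refine ⟨X, ⊤, μ, ⟨T, measurable_from_top, measurable_from_top⟩, inferInstance,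
    measurePreserving_uniformOn_univ _, f,
    memLp_top_of_bound measurable_from_top.aestronglyMeasurable 1 hf',
    by simpa using eLpNorm_le_of_ae_bound (p := ∞) hf', ?_⟩
  calc (C : ℝ≥0∞) < r * 2⁻¹ ^ (1 / p.toReal) := hr
    _ ≤ r * μ (s : Set X)ᶜ ^ (1 / p.toReal) := by gcongr
    _ ≤ _ := mul_measure_rpow_le_eLpNorm hp.ne' s.measurableSet.compl
      ((ENNReal.inv_pos.2 ENNReal.ofNat_ne_top).trans_le hμs).ne' hvar
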